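/- Let $\Gamma$ be a finite group, $K/K_0$ a Galois extension of number fields with a fixed isomorphism $\tau:\mathrm{Gal}(K/K_0)\cong\Gamma$, and $S$ a (possibly infinite) set of primes not dividing $|\Gamma|$. Let $\mathbb Z_S$ be the localization of $\mathbb Z$ at the nonzero integers not divisible by any prime in $S$. Let $e_1=|\Gamma|^{-1}\sum_{\sigma\in\Gamma}\sigma$, and write $(1-e_1)\mathbb Z_S[\Gamma]$ for the ring $\mathbb Z_S[\Gamma]/e_1\mathbb Z_S[\Gamma]$. Let $e_2,\dots,e_m$ be the irreducible central idempotents of $\mathbb Q[\Gamma]$ other than $e_1$; for each $i$ let $\chi_i$ be the character of the irreducible $\mathbb Q$-representation of $\Gamma$ on which $e_i$ acts as the identity, let $\varphi_i$ be any absolutely irreducible character contained in $\chi_i$, and let $h_i>0$ be given by $h_i^2=\dim_{K_i}e_i\mathbb Q[\Gamma]$, where $K_i$ is the center of $e_i\mathbb Q[\Gamma]$. For each infinite place $v$ of $K_0$ let $\Gamma_v\subseteq\Gamma$ be the decomposition group of a chosen place of $K$ above $v$, and let $$\chi_K=-1+\sum_{v\mid\infty}\mathrm{Ind}_{\Gamma_v}^{\Gamma}1,\qquad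 u_i=\tfrac1{h_i}\langle\chi_K,\varphi_i\rangle\quad(2\le i\le m).$$ For a finite $(1-e_1)\mathbb Z_S[\Gamma]$-module $H$ put $|H|^{\underline u}=\prod_{i=2}^m|e_iH|^{u_i}$. 1. For every finite $(1-e_1)\mathbb Z_S[\Gamma]$-module $H$, $$|H|^{\underline u}=\prod_{v\mid\infty}|H^{\Gamma_v}|,$$ where $v$ runs over all infinite places of $K_0$. 2. Call a random isomorphism class $X$ of finite $(1-e_1)\mathbb Z_S[\Gamma]$-modules a Cohen–Martinet random module of rank $\underline u$ if $$\frac{\mathbb P(X\cong G_1)}{\mathbb P(X\cong G_2)}=\frac{|G_2|^{\underline u}\,|\mathrm{Aut}_\Gamma(G_2)|}{|G_1|^{\underline u}\,|\mathrm{Aut}_\Gamma(G_1)|}$$ for all finite $(1-e_1)\mathbb Z_S[\Gamma]$-modules $G_1,G_2$. Then $X$ is such a random module if and only if there is a constant $c>0$ with $$\mathbb P(X\cong H)=\frac{c}{\prod_{v\mid\infty}|H^{\Gamma_v}|\cdot|\mathrm{Aut}_\Gamma(H)|}\quad\text{for all }H.$$ In particular, if $K_0=\mathbb Q$ and $\Gamma_\infty$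 is the decomposition group of any infinite place of $K$, this condition reads $\mathbb P(X\cong H)=c/(|H^{\Gamma_\infty}|\,|\mathrm{Aut}_\Gamma(H)|)$ for all $H$. -/

import Mathlib

open scoped ComplexConjugate

noncomputable section

namespace CohenMartinet

section GroupRing

/-- The nonzero integers that are not divisible by any prime of `S`. -/
def primeToS (S : Set Nat.Primes) : Submonoid ℤ where
  carrier := {n | n ≠ 0 ∧ ∀ p ∈ S, ¬ ((p : ℕ) : ℤ) ∣ n}
  one_mem' := ⟨one_ne_zero, fun p _ h =>
    p.2.one_lt.ne' (Nat.dvd_one.mp (by exact_mod_cast h))⟩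
  mul_mem' := by
    rintro a b ⟨ha, ha'⟩ ⟨hb, hb'⟩
    refine ⟨mul_ne_zero ha hb, fun p hp h => ?_⟩
    rcases (Nat.prime_iff_prime_int.mp p.2).dvd_or_dvd h with h | h
    · exact ha' p hp h
    · exact hb' p hp h

/-- `ℤ_S`, the localization of `ℤ` at the nonzero integers not divisible by any prime of `S`. -/
abbrev ZS (S : Set Nat.Primes) : Type := Localization (primeToS S)

/-- The inclusion `ℤ_S → ℚ`. -/
def ZS.toRat (S : Set Nat.Primes) : ZS S →+* ℚ :=
  IsLocalization.lift (M := primeToS S) (g := Int.castRingHom ℚ) fun y =>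
    isUnit_iff_ne_zero.mpr (by simpa using y.2.1)

variable (Γ : Type*) [Group Γ] [Fintype Γ]

/-- `e₁ = |Γ|⁻¹ ∑ σ` in `R[Γ]`. It is only used when `|Γ|` is a unit of `R`, and then
`Ring.inverse` is the inverse. -/
def e₁ (R : Type*) [CommRing R] : MonoidAlgebra R Γ :=
  Ring.inverse (Fintype.card Γ : R) • ∑ σ : Γ, MonoidAlgebra.single σ 1

theorem e₁_central (R : Type*) [CommRing R] (x : MonoidAlgebra R Γ) :
    e₁ Γ R * x = x * e₁ Γ R := by
  induction x using MonoidAlgebra.induction_on with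
  | of g =>
    simp only [e₁, smul_mul_assoc, mul_smul_comm, Finset.sum_mul, Finset.mul_sum,
      MonoidAlgebra.of_apply, MonoidAlgebra.single_mul_single, mul_one]
    congr 1
    exact (Equiv.sum_comp (Equiv.mulRight g)
        (fun x => (MonoidAlgebra.single x 1 : MonoidAlgebra R Γ))).trans
      (Equiv.sum_comp (Equiv.mulLeft g)
        (fun x => (MonoidAlgebra.single x 1 : MonoidAlgebra R Γ))).symm
  | add a b ha hb => rw [mul_add, add_mul, ha, hb]
  | smul r a ha => rw [mul_smul_comm, smul_mul_assoc, ha]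

instance e₁_isTwoSided (R : Type*) [CommRing R] :
    (Ideal.span {e₁ Γ R} : Ideal (MonoidAlgebra R Γ)).IsTwoSided where
  mul_mem_of_left {a} b ha := by
    obtain ⟨c, rfl⟩ := Ideal.mem_span_singleton'.mp ha
    rw [mul_assoc, e₁_central, ← mul_assoc]
    exact Ideal.mem_span_singleton'.mpr ⟨_, rfl⟩

/-- The ring `(1 - e₁) ℤ_S[Γ]`, as the quotient `ℤ_S[Γ] / e₁ ℤ_S[Γ]`. -/
abbrev ReducedRing (S : Set Nat.Primes) :=
  MonoidAlgebra (ZS S) Γ ⧸ (Ideal.span {e₁ Γ (ZS S)} : Ideal (MonoidAlgebra (ZS S) Γ))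

/-- The projection `ℤ_S[Γ] → (1 - e₁) ℤ_S[Γ]`. -/
def toReduced (S : Set Nat.Primes) : MonoidAlgebra (ZS S) Γ →+* ReducedRing Γ S :=
  Ideal.Quotient.mk _

end GroupRing

section Idempotents

/-- The irreducible (primitive) central idempotents of a ring. -/
structure IsIrredCentralIdem {A : Type*} [Ring A] (e : A) : Prop where
  idem : IsIdempotentElem e
  central : e ∈ Set.center A
  ne_zero : e ≠ 0
  irred : ∀ f : A, IsIdempotentElem f → f ∈ Set.center A → f * e = f → f = 0 ∨ f = e

theorem IsIrredCentralIdem.mul_eq_zero {A : Type*} [Ring A] {e f : A}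
    (he : IsIrredCentralIdem e) (hf : IsIrredCentralIdem f) (h : e ≠ f) : e * f = 0 := by
  have hc : e * f = f * e := (he.central.comm f)
  have h1 : IsIdempotentElem (e * f) := by
    unfold IsIdempotentElem
    rw [mul_assoc, ← mul_assoc f e f, ← hc, mul_assoc e f f, hf.idem.eq, ← mul_assoc, he.idem.eq]
  have h2 : e * f ∈ Set.center A := Set.mul_mem_center he.central hf.central
  rcases he.irred _ h1 h2 (by rw [hc, mul_assoc, he.idem.eq]) with h3 | h3
  · exact h3
  · rcases hf.irred _ h1 h2 (by rw [mul_assoc, hf.idem.eq]) with h4 | h4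
    · exact h4
    · exact absurd (h3.symm.trans h4) h

instance finite_irredCentralIdem {A : Type*} [Ring A] [Algebra ℚ A] [FiniteDimensional ℚ A] :
    Finite {e : A // IsIrredCentralIdem e} := by
  have : LinearIndependent ℚ (Subtype.val : {e : A // IsIrredCentralIdem e} → A) := by
    classical
    rw [linearIndependent_iff']
    intro s g hg i hi
    have h := congrArg (· * i.1) hg
    simp only [Finset.sum_mul, zero_mul, smul_mul_assoc] at h
    rw [Finset.sum_eq_single_of_mem i hi fun j _ hj => by
      rw [j.2.mul_eq_zero i.2 fun h => hj (Subtype.ext h), smul_zero], i.2.idem.eq] at h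
    exact (smul_eq_zero.mp h).resolve_right i.2.ne_zero
  exact this.finite

/-- `h` with `h² = dim_Z (eA)`, where `Z` is the center of the ring `eA = eAe`
(for `e` an irreducible central idempotent of a semisimple algebra this dimension is a square). -/
def hDim {A : Type*} [Ring A] {e : A} (he : IsIrredCentralIdem e) : ℝ :=
  Real.sqrt (Module.finrank (Subring.center he.idem.Corner) he.idem.Corner)

variable (Γ : Type*) [Group Γ] [Fintype Γ]

/-- The irreducible central idempotents `e₂, …, e_m` of `ℚ[Γ]` other than `e₁`. -/
abbrev Idx : Type _ :=
  {e : {e : MonoidAlgebra ℚ Γ // IsIrredCentralIdem e} // e.1 ≠ e₁ Γ ℚ}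

end Idempotents

section Modules

variable {Γ : Type*} [Group Γ] [Fintype Γ] {S : Set Nat.Primes}
  (H : Type*) [AddCommGroup H] [Module (ReducedRing Γ S) H]

/-- `eH` for `e ∈ ℚ[Γ]`: the image of multiplication by `e`, regarded as an element of `ℤ_S[Γ]`.
The inclusion `ℤ_S[Γ] → ℚ[Γ]` is injective, and its image contains each central
idempotent `e` if no prime of `S` divides `|Γ|`; so the supremum has exactly one term. -/
def idemPart (e : MonoidAlgebra ℚ Γ) : AddSubgroup H :=
  ⨆ r : {r : MonoidAlgebra (ZS S) Γ // MonoidAlgebra.mapRingHom Γ (ZS.toRat S) r = e},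
    (DistribSMul.toAddMonoidHom H (toReduced Γ S r.1)).range

/-- `|H|^u = ∏ᵢ |eᵢ H|^{uᵢ}`, the product being over the finite set `Idx Γ`. -/
def weight (u : Idx Γ → ℝ) : ℝ :=
  ∏ᶠ i : Idx Γ, (Nat.card (idemPart (S := S) H i.1.1) : ℝ) ^ u i

/-- The fixed points `H^Δ`. -/
def fixedPart (Δ : Subgroup Γ) : Set H :=
  {x | ∀ γ ∈ Δ, toReduced Γ S (MonoidAlgebra.of (ZS S) Γ γ) • x = x}

end Modules

section Rank

variable {Γ : Type*} [Group Γ] [Fintype Γ]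

/-- `⟨χ, ψ⟩ = |Γ|⁻¹ ∑ χ(g) conj ψ(g)`. -/
def pairing (χ ψ : Γ → ℂ) : ℂ :=
  (Fintype.card Γ : ℂ)⁻¹ * ∑ g : Γ, χ g * conj (ψ g)

open Classical in
/-- The class function on `Γ` induced from a class function on the subgroup `Δ`. -/
def induced (Δ : Subgroup Γ) (f : Δ → ℂ) (g : Γ) : ℂ :=
  (Nat.card Δ : ℂ)⁻¹ * ∑ x : Γ, if h : x⁻¹ * g * x ∈ Δ then f ⟨x⁻¹ * g * x, h⟩ else 0

/-- `χ` is the character of an irreducible `ℚ`-representation on which `e` acts as the identity. -/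
def IsRatCharOf (e : MonoidAlgebra ℚ Γ) (χ : Γ → ℚ) : Prop :=
  ∃ (n : ℕ) (ρ : Representation ℚ Γ (Fin n → ℚ)),
    ρ.IsIrreducible ∧ ρ.asAlgebraHom e = 1 ∧ χ = ρ.character

/-- `φ` is an absolutely irreducible character of `Γ`. -/
def IsAbsIrredChar (φ : Γ → ℂ) : Prop :=
  ∃ (n : ℕ) (ρ : Representation ℂ Γ (Fin n → ℂ)), ρ.IsIrreducible ∧ φ = ρ.character

/-- `φ` is an absolutely irreducible character contained in the irreducible rational character
corresponding to `e`. -/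
def IsAbsIrredCharIn (e : MonoidAlgebra ℚ Γ) (φ : Γ → ℂ) : Prop :=
  IsAbsIrredChar φ ∧ ∃ χ : Γ → ℚ, IsRatCharOf e χ ∧ pairing (fun g => (χ g : ℂ)) φ ≠ 0

variable {K₀ K : Type*} [Field K₀] [NumberField K₀] [Field K] [NumberField K] [Algebra K₀ K]

/-- The decomposition group in `Γ` of an infinite place of `K`, where `τ : Gal(K/K₀) ≃ Γ`. -/
def decomp (τ : Gal(K/K₀) ≃* Γ) (w : NumberField.InfinitePlace K) : Subgroup Γ :=
  (MulAction.stabilizer Gal(K/K₀) w).map τ.toMonoidHom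

/-- `χ_K = -1 + ∑_{v ∣ ∞} Ind_{Γ_v}^Γ 1`, where `Γ_v` is the decomposition group of the place
`w v` of `K` above `v`. -/
def chiK (τ : Gal(K/K₀) ≃* Γ)
    (w : NumberField.InfinitePlace K₀ → NumberField.InfinitePlace K) (g : Γ) : ℂ :=
  -1 + ∑ v : NumberField.InfinitePlace K₀, induced (decomp τ (w v)) (fun _ => 1) g

/-- The rank of `K/K₀`: `uᵢ = hᵢ⁻¹ ⟨χ_K, φᵢ⟩` (this pairing is an integer). -/
def rank (τ : Gal(K/K₀) ≃* Γ)
    (w : NumberField.InfinitePlace K₀ → NumberField.InfinitePlace K)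
    (φ : Idx Γ → Γ → ℂ) (i : Idx Γ) : ℝ :=
  1 / hDim i.1.2 * (pairing (chiK τ w) (φ i)).re

end Rank

section RandomModule

/-- Finite modules over a ring. -/
structure FinMod (E : Type*) [Ring E] where
  carrier : Type
  [addCommGroup : AddCommGroup carrier]
  [module : Module E carrier]
  [finite : Finite carrier]

attribute [instance] FinMod.addCommGroup FinMod.module FinMod.finite

/-- Isomorphism of finite modules. -/
instance FinMod.setoid (E : Type*) [Ring E] : Setoid (FinMod E) where
  r M N := Nonempty (M.carrier ≃ₗ[E] N.carrier)
  iseqv := ⟨fun _ => ⟨.refl _ _⟩, fun ⟨f⟩ => ⟨f.symm⟩, fun ⟨f⟩ ⟨g⟩ => ⟨f.trans g⟩⟩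

/-- Isomorphism classes of finite modules. -/
abbrev IsoClass (E : Type*) [Ring E] := Quotient (FinMod.setoid E)

variable {Γ : Type*} [Group Γ] [Fintype Γ] {S : Set Nat.Primes}

/-- `|Aut_Γ(G)|`. -/
def autCard (G : FinMod (ReducedRing Γ S)) : ℝ :=
  Nat.card (G.carrier ≃ₗ[ReducedRing Γ S] G.carrier)

/-- The probability, under the law `P`, that a random module is isomorphic to `G`. -/
def prob (P : PMF (IsoClass (ReducedRing Γ S))) (G : FinMod (ReducedRing Γ S)) : ℝ :=
  (P ⟦G⟧).toReal

/-- `P` is the law of the Cohen–Martinet random `(1 - e₁) ℤ_S[Γ]`-module with parameter `u`.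
(Since `x / 0 = 0` while the right-hand side is positive, all probabilities are nonzero.) -/
def IsCohenMartinetLaw (u : Idx Γ → ℝ) (P : PMF (IsoClass (ReducedRing Γ S))) : Prop :=
  ∀ G₁ G₂ : FinMod (ReducedRing Γ S),
    prob P G₁ / prob P G₂ =
      (weight (S := S) G₂.carrier u * autCard G₂) / (weight (S := S) G₁.carrier u * autCard G₁)

end RandomModule

end CohenMartinet

end

/-!
Fix an absolutely irreducible `φᵢ`, of degree `hᵢ` and afforded by `V`, so that `eᵢ` acts on `V` as
the identity. Let `s_v` be the average of the elements of `Γ_v`. The corner `eᵢℚ[Γ]` is a simple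
ring whose image spans `End V` over `ℂ`, and its modules are classified by their dimension, whence
`(ℚ[Γ] eᵢ s_v) ^ hᵢ ≃ (ℚ[Γ] eᵢ) ^ dim V^{Γ_v}`.

Modulo every prime, `ℤ_S[Γ]` is semisimple by Maschke, so two projective lattices spanning the same
rational module have equally many homomorphisms to any finite module `H`. Homomorphisms from the
left ideal of an idempotent `c` to `H` are the elements of `cH`; hence
`|eᵢ s_v H| ^ hᵢ = |eᵢ H| ^ dim V^{Γ_v}`. Frobenius reciprocity gives `⟨χ_K, φᵢ⟩ = ∑ dim V^{Γ_v}`,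
the trivial character being orthogonal to `φᵢ`, and `H^{Γ_v} = s_v H` is the direct sum of the
`eᵢ s_v H`.

A law with prescribed ratios is determined up to a constant, so the condition on `X` is only
rewritten by the formula for the weights; over `ℚ` there is a single infinite place, and the
decomposition groups above it are conjugate.
-/

noncomputable section

namespace CohenMartinet

section HomCounting

theorem natCard_eq_of_ker_eq_range {R G H : Type*} [Ring R] [AddCommGroup G] [Module R G]
    [AddCommGroup H] [Module R H] {φ : G →ₗ[R] H} {ψ : H →ₗ[R] G}
    (hφ : LinearMap.ker φ = LinearMap.range ψ) (hψ : LinearMap.ker ψ = LinearMap.range φ) :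
    Nat.card G = Nat.card H := by
  rw [Submodule.card_eq_card_quotient_mul_card (LinearMap.ker φ),
    Submodule.card_eq_card_quotient_mul_card (LinearMap.ker ψ),
    Nat.card_congr φ.quotKerEquivRange.toEquiv, Nat.card_congr ψ.quotKerEquivRange.toEquiv, hφ, hψ,
    mul_comm]

theorem bijective_nsmul_of_coprime {G : Type*} [AddCommGroup G] {m n : ℕ} (h : m.Coprime n)
    (hG : ∀ x : G, n • x = 0) : Function.Bijective fun x : G => m • x := by
  let _ : Module (ZMod n) G := AddCommGroup.zmodModule hG
  simp only [← Nat.cast_smul_eq_nsmul (ZMod n) m]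
  exact ((ZMod.isUnit_iff_coprime m n).mpr h).smul_bijective

variable {A : Type*} [Ring A]

theorem exists_comp_eq_of_ker_le {X V M : Type*} [AddCommGroup X] [Module A X] [AddCommGroup V]
    [Module A V] [AddCommGroup M] [Module A M] [IsSemisimpleModule A V] (j : X →ₗ[A] V)
    (g : X →ₗ[A] M) (h : LinearMap.ker j ≤ LinearMap.ker g) : ∃ g' : V →ₗ[A] M, g' ∘ₗ j = g := by
  obtain ⟨g', hg'⟩ := IsSemisimpleModule.extension_property ((LinearMap.ker j).liftQ j le_rfl)
    (LinearMap.ker_eq_bot.mp (Submodule.ker_liftQ_eq_bot' _ j rfl)) ((LinearMap.ker j).liftQ g h)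
  exact ⟨g', LinearMap.ext fun x => LinearMap.congr_fun hg' (Submodule.Quotient.mk x)⟩

/-- The ring `A` is semisimple modulo every prime number. The quotient is taken as a left module,
which spares the two-sidedness of the ideal. -/
def IsSemisimpleModPrimes (A : Type*) [Ring A] : Prop :=
  ∀ p : ℕ, p.Prime → IsSemisimpleModule A (A ⧸ Ideal.span {(p : A)})

theorem IsSemisimpleModPrimes.isSemisimpleModule (hA : IsSemisimpleModPrimes A) {p : ℕ}
    (hp : p.Prime) {M : Type*} [AddCommGroup M] [Module A M] (hM : ∀ x : M, p • x = 0) :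
    IsSemisimpleModule A M := by
  have := hA p hp
  have cyclic (x : M) :
      IsSemisimpleModule A (LinearMap.range (LinearMap.toSpanSingleton A M x)) := by
    have hx : Ideal.span {(p : A)} ≤ LinearMap.ker (LinearMap.toSpanSingleton A M x) := by
      rw [Ideal.span_singleton_le_iff_mem]
      simpa [Nat.cast_smul_eq_nsmul] using hM x
    rw [← Submodule.range_liftQ _ _ hx]
    exact .of_surjective _ (LinearMap.surjective_rangeRestrict _)
  exact isSemisimpleModule_of_isSemisimpleModule_submodule' cyclic
    (eq_top_iff.mpr fun x _ => Submodule.mem_iSup_of_mem x ⟨1, by simp⟩)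

section Precomposition

variable {P Q M : Type*} [AddCommGroup P] [Module A P] [AddCommGroup Q] [Module A Q]
  [AddCommGroup M] [Module A M]

theorem ker_lcomp_eq_range (hA : IsSemisimpleModPrimes A) {p : ℕ} (hp : p.Prime)
    (hM : ∀ x : M, p • x = 0) [IsAddTorsionFree Q] {f : P →ₗ[A] Q} {g : Q →ₗ[A] P}
    (hfg : f ∘ₗ g = p • LinearMap.id) (hgf : g ∘ₗ f = p • LinearMap.id) :
    LinearMap.ker (LinearMap.lcomp ℤ M f) = LinearMap.range (LinearMap.lcomp ℤ M g) := by
  have hfg' (y) : f (g y) = p • y := LinearMap.congr_fun hfg y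
  have hgf' (x) : g (f x) = p • x := LinearMap.congr_fun hgf x
  have hg : Function.Injective g := fun x y h =>
    nsmul_right_injective hp.ne_zero (by simp only [← hfg', h])
  refine le_antisymm (fun h hh => ?_) ?_
  · let pP : Submodule A P := LinearMap.range (p • LinearMap.id : P →ₗ[A] P)
    have := hA.isSemisimpleModule hp (M := P ⧸ pP) fun x => by
      obtain ⟨x, rfl⟩ := pP.mkQ_surjective x
      rw [← map_nsmul]
      exact (Submodule.Quotient.mk_eq_zero _).mpr ⟨x, rfl⟩
    obtain ⟨h', hh'⟩ := exists_comp_eq_of_ker_le (pP.mkQ ∘ₗ g) h fun y hy => by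
      obtain ⟨x, hx⟩ := (Submodule.Quotient.mk_eq_zero _).mp hy
      obtain rfl : f x = y := hg ((hgf' x).trans hx)
      exact LinearMap.congr_fun hh x
    exact ⟨h' ∘ₗ pP.mkQ, hh'⟩
  · rintro _ ⟨h, rfl⟩
    refine LinearMap.ext fun x => ?_
    change h (g (f x)) = 0
    rw [hgf', map_nsmul, hM]

theorem natCard_linearMap_eq_of_comp_eq_prime_smul (hA : IsSemisimpleModPrimes A) {p q : ℕ}
    (hp : p.Prime) (hq : q.Prime) (hM : ∀ x : M, q • x = 0) [IsAddTorsionFree P]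
    [IsAddTorsionFree Q] {f : P →ₗ[A] Q} {g : Q →ₗ[A] P} (hfg : f ∘ₗ g = p • LinearMap.id)
    (hgf : g ∘ₗ f = p • LinearMap.id) : Nat.card (P →ₗ[A] M) = Nat.card (Q →ₗ[A] M) := by
  obtain rfl | hpq := eq_or_ne p q
  · exact (natCard_eq_of_ker_eq_range (ker_lcomp_eq_range hA hp hM hfg hgf)
      (ker_lcomp_eq_range hA hp hM hgf hfg)).symm
  have hcop : p.Coprime q := (Nat.coprime_primes hp hq).mpr hpq
  have hfg' : LinearMap.lcomp ℤ M g ∘ LinearMap.lcomp ℤ M f = fun h => p • h := by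
    ext h y
    exact (congrArg h (LinearMap.congr_fun hfg y)).trans (map_nsmul h p y)
  have hgf' : LinearMap.lcomp ℤ M f ∘ LinearMap.lcomp ℤ M g = fun h => p • h := by
    ext h x
    exact (congrArg h (LinearMap.congr_fun hgf x)).trans (map_nsmul h p x)
  refine Nat.card_eq_of_bijective (LinearMap.lcomp ℤ M g)
    ⟨.of_comp (f := LinearMap.lcomp ℤ M f) ?_, .of_comp (g := LinearMap.lcomp ℤ M f) ?_⟩
  · rw [hgf']
    exact (bijective_nsmul_of_coprime hcop fun h => LinearMap.ext fun x => hM (h x)).1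
  · rw [hfg']
    exact (bijective_nsmul_of_coprime hcop fun h => LinearMap.ext fun x => hM (h x)).2

theorem natCard_linearMap_eq_mul [Module.Projective A P] (N : Submodule A M) :
    Nat.card (P →ₗ[A] M) = Nat.card (P →ₗ[A] N) * Nat.card (P →ₗ[A] M ⧸ N) := by
  let φ : (P →ₗ[A] M) →+ (P →ₗ[A] M ⧸ N) :=
    AddMonoidHom.mk' (N.mkQ ∘ₗ ·) fun g h => LinearMap.comp_add g h N.mkQ
  have hφ : Function.Surjective φ := fun h =>
    Module.projective_lifting_property N.mkQ h N.mkQ_surjective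
  let kerEquiv : φ.ker ≃ (P →ₗ[A] N) :=
    { toFun h := h.1.codRestrict N fun x =>
        (Submodule.Quotient.mk_eq_zero N).mp (LinearMap.congr_fun h.2 x)
      invFun h := ⟨N.subtype ∘ₗ h, LinearMap.ext fun x =>
        (Submodule.Quotient.mk_eq_zero N).mpr (h x).2⟩
      left_inv _ := rfl
      right_inv _ := rfl }
  rw [← φ.ker.card_mul_index, AddSubgroup.index_ker, Nat.card_congr kerEquiv,
    AddMonoidHom.range_eq_top.mpr hφ, AddSubgroup.card_top]

theorem natCard_linearMap_eq_of_nsmul_mem (hA : IsSemisimpleModPrimes A) {q : ℕ} (hq : q.Prime)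
    (hM : ∀ x : M, q • x = 0) [IsAddTorsionFree Q] {m : ℕ} (hm : m ≠ 0) :
    ∀ P : Submodule A Q, (∀ y : Q, m • y ∈ P) → Nat.card (P →ₗ[A] M) = Nat.card (Q →ₗ[A] M) := by
  induction m using induction_on_primes with
  | zero => exact absurd rfl hm
  | one =>
    intro P hP
    obtain rfl : P = ⊤ := eq_top_iff.mpr fun y _ => by simpa using hP y
    exact Nat.card_congr (Submodule.topEquiv.congrLeft M ℕ).toEquiv
  | prime_mul p a hp ih =>
    intro P hP
    let P' : Submodule A Q := P.comap (p • LinearMap.id)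
    have hPP' : P ≤ P' := fun x hx => P.nsmul_mem hx p
    rw [← ih (right_ne_zero_of_mul hm) P' fun y => by simpa [P', mul_nsmul] using hP y]
    have torsionFree (N : Submodule A Q) : IsAddTorsionFree N :=
      Function.Injective.isAddTorsionFree N.subtype.toAddMonoidHom N.subtype_injective
    exact natCard_linearMap_eq_of_comp_eq_prime_smul hA hp hq hM
      (f := Submodule.inclusion hPP')
      (g := ((p • LinearMap.id) ∘ₗ P'.subtype).codRestrict P fun x => x.2) rfl rfl

universe u in
theorem natCard_linearMap_eq_of_projective [Module.Projective A P] [Module.Projective A Q]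
    (h : ∀ (N : Type u) [AddCommGroup N] [Module A N] (q : ℕ), q.Prime → (∀ x : N, q • x = 0) →
      Nat.card (P →ₗ[A] N) = Nat.card (Q →ₗ[A] N)) {d : ℕ} (hd : d ≠ 0) :
    ∀ (M : Type u) [AddCommGroup M] [Module A M], (∀ x : M, d • x = 0) →
      Nat.card (P →ₗ[A] M) = Nat.card (Q →ₗ[A] M) := by
  induction d using induction_on_primes with
  | zero => exact absurd rfl hd
  | one =>
    intro M _ _ hM
    have : Subsingleton M := ⟨fun x y => by simpa using (hM x).trans (hM y).symm⟩
    rw [Nat.card_unique, Nat.card_unique]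
  | prime_mul p a hp ih =>
    intro M _ _ hM
    let N : Submodule A M := LinearMap.range (p • LinearMap.id : M →ₗ[A] M)
    have hN (x : N) : a • x = 0 := by
      obtain ⟨_, x, rfl⟩ := x
      exact Subtype.ext (by simpa [mul_nsmul] using hM x)
    have hMN (x : M ⧸ N) : p • x = 0 := by
      obtain ⟨x, rfl⟩ := N.mkQ_surjective x
      exact (Submodule.Quotient.mk_eq_zero N).mpr ⟨x, rfl⟩
    rw [natCard_linearMap_eq_mul N, natCard_linearMap_eq_mul N, h _ p hp hMN,
      ih (right_ne_zero_of_mul hd) N hN]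

end Precomposition

section Lattices

variable {C : Type*} [Ring C] {f : A →+* C} {V : Type*} [AddCommGroup V] [Module C V]

/-- The semilinear map `j` embeds `P` as a lattice in `V`: it is injective, and every vector has a
nonzero integral multiple in its image. -/
structure IsLatticeEmbedding {P : Type*} [AddCommGroup P] [Module A P] (j : P →ₛₗ[f] V) :
    Prop where
  injective : Function.Injective j
  exists_nsmul_mem_range (v : V) : ∃ m : ℕ, m ≠ 0 ∧ m • v ∈ Set.range j

variable {P Q : Type*} [AddCommGroup P] [Module A P] [AddCommGroup Q] [Module A Q]
  {j : P →ₛₗ[f] V} {j' : Q →ₛₗ[f] V}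

theorem IsLatticeEmbedding.isAddTorsionFree [IsAddTorsionFree V] (hj : IsLatticeEmbedding j) :
    IsAddTorsionFree P :=
  Function.Injective.isAddTorsionFree j.toAddMonoidHom hj.injective

theorem IsLatticeEmbedding.exists_nsmul_mem_of_finite (hj' : IsLatticeEmbedding j')
    [Module.Finite A P] (j : P →ₛₗ[f] V) : ∃ m : ℕ, m ≠ 0 ∧ ∀ x, m • j x ∈ Set.range j' := by
  classical
  obtain ⟨s, hs⟩ := (Module.finite_def (R := A) (M := P)).mp inferInstance
  choose m hm hmem using hj'.exists_nsmul_mem_range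
  refine ⟨∏ x ∈ s, m (j x), Finset.prod_ne_zero_iff.mpr fun x _ => hm _, fun x => ?_⟩
  induction hs.ge (Submodule.mem_top (x := x)) using Submodule.span_induction with
  | mem x hx =>
    obtain ⟨y, hy⟩ := hmem (j x)
    rw [← Finset.mul_prod_erase s _ hx, mul_nsmul, ← hy, ← map_nsmul]
    exact ⟨_, rfl⟩
  | zero => exact ⟨0, by simp⟩
  | add x y _ _ hx hy =>
    obtain ⟨⟨x', hx⟩, y', hy⟩ := And.intro hx hy
    exact ⟨x' + y', by rw [map_add, map_add, nsmul_add, hx, hy]⟩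
  | smul a x _ hx =>
    obtain ⟨x', hx⟩ := hx
    exact ⟨a • x', by rw [map_smulₛₗ, map_smulₛₗ, hx, smul_comm]⟩

theorem IsLatticeEmbedding.exists_linearMap (hj' : IsLatticeEmbedding j') [Module.Finite A P]
    (j : P →ₛₗ[f] V) : ∃ m : ℕ, m ≠ 0 ∧ ∃ g : P →ₗ[A] Q, ∀ x, j' (g x) = m • j x := by
  obtain ⟨m, hm, hmem⟩ := hj'.exists_nsmul_mem_of_finite j
  choose g hg using hmem
  refine ⟨m, hm, ⟨⟨g, fun x y => hj'.injective ?_⟩, fun a x => hj'.injective ?_⟩, hg⟩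
  · simp only [map_add, hg, nsmul_add]
  · simp only [map_smulₛₗ, hg, smul_comm m, RingHom.id_apply]

/-- The integral form of the Brauer–Nesbitt theorem: lattices in the same module have isomorphic
reductions up to semisimplification, so that they have equally many homomorphisms to `M`. -/
theorem IsLatticeEmbedding.natCard_linearMap_eq (hA : IsSemisimpleModPrimes A) [IsAddTorsionFree V]
    [Module.Finite A P] [Module.Projective A P] [Module.Finite A Q] [Module.Projective A Q]
    (hj : IsLatticeEmbedding j) (hj' : IsLatticeEmbedding j') (M : Type*) [AddCommGroup M]
    [Module A M] [Finite M] : Nat.card (P →ₗ[A] M) = Nat.card (Q →ₗ[A] M) := by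
  have := hj'.isAddTorsionFree
  obtain ⟨m, hm, g, hg⟩ := hj'.exists_linearMap j
  obtain ⟨m', hm', g', hg'⟩ := hj.exists_linearMap j'
  have hg_inj : Function.Injective g := fun x y h =>
    hj.injective (nsmul_right_injective hm (by simp only [← hg, h]))
  have hgg' (y : Q) : (m * m') • y ∈ LinearMap.range g :=
    ⟨g' y, hj'.injective (by rw [hg, hg', map_nsmul, smul_smul])⟩
  refine natCard_linearMap_eq_of_projective (fun N _ _ q hq hN => ?_) Nat.card_pos.ne' M
    fun x => card_nsmul_eq_zero'
  rw [← natCard_linearMap_eq_of_nsmul_mem hA hq hN (mul_ne_zero hm hm') _ hgg']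
  exact Nat.card_congr ((LinearEquiv.ofInjective g hg_inj).congrLeft N ℕ).toEquiv

theorem IsLatticeEmbedding.comp_linearEquiv (hj : IsLatticeEmbedding j) {W : Type*}
    [AddCommGroup W] [Module C W] (θ : V ≃ₗ[C] W) :
    IsLatticeEmbedding (θ.toLinearMap ∘ₛₗ j) where
  injective := θ.injective.comp hj.injective
  exists_nsmul_mem_range w := by
    obtain ⟨m, hm, x, hx⟩ := hj.exists_nsmul_mem_range (θ.symm w)
    refine ⟨m, hm, x, ?_⟩
    rw [LinearMap.comp_apply, hx, map_nsmul, LinearEquiv.coe_coe, θ.apply_symm_apply]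

/-- The coordinatewise application of a semilinear map. -/
def piMapₛₗ (n : ℕ) (j : P →ₛₗ[f] V) : (Fin n → P) →ₛₗ[f] (Fin n → V) where
  toFun x i := j (x i)
  map_add' x y := funext fun i => map_add j (x i) (y i)
  map_smul' a x := funext fun i => map_smulₛₗ j a (x i)

theorem IsLatticeEmbedding.piMapₛₗ (hj : IsLatticeEmbedding j) (n : ℕ) :
    IsLatticeEmbedding (piMapₛₗ n j) where
  injective x y h := funext fun i => hj.injective (congrFun h i)
  exists_nsmul_mem_range v := by
    choose m hm x hx using fun i => hj.exists_nsmul_mem_range (v i)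
    refine ⟨∏ i, m i, Finset.prod_ne_zero_iff.mpr fun i _ => hm i,
      fun i => (∏ k ∈ Finset.univ.erase i, m k) • x i, funext fun i => ?_⟩
    change j _ = (∏ i, m i) • v i
    rw [map_nsmul, hx, smul_smul, Finset.prod_erase_mul _ _ (Finset.mem_univ i)]

end Lattices

section IdempotentIdeals

variable {c : A} {M : Type*} [AddCommGroup M] [Module A M]

theorem mul_eq_of_mem_span_singleton (hc : IsIdempotentElem c) {x : A} (hx : x ∈ Ideal.span {c}) :
    x * c = x := by
  obtain ⟨a, rfl⟩ := Ideal.mem_span_singleton'.mp hx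
  rw [mul_assoc, hc.eq]

theorem projective_span_singleton (hc : IsIdempotentElem c) :
    Module.Projective A (Ideal.span {c}) :=
  .of_split (Ideal.span {c}).subtype
    ((LinearMap.toSpanSingleton A A c).codRestrict (Ideal.span {c}) fun a =>
      Ideal.mul_mem_left _ a (Ideal.mem_span_singleton_self c))
    (LinearMap.ext fun x => Subtype.ext (mul_eq_of_mem_span_singleton hc x.2))

theorem natCard_linearMap_span_singleton (hc : IsIdempotentElem c) :
    Nat.card (Ideal.span {c} →ₗ[A] M) =
      Nat.card (DistribSMul.toAddMonoidHom M c).range := by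
  have hcmem := Ideal.mem_span_singleton_self c
  refine Nat.card_congr
    { toFun h := ⟨h ⟨c, hcmem⟩, h ⟨c, hcmem⟩, ?_⟩
      invFun x := LinearMap.toSpanSingleton A M x ∘ₗ (Ideal.span {c}).subtype
      left_inv h := LinearMap.ext fun x => ?_
      right_inv x := Subtype.ext ?_ }
  · exact (map_smul h c _).symm.trans (congrArg h (Subtype.ext hc.eq))
  · exact (map_smul h x.1 _).symm.trans
      (congrArg h (Subtype.ext (mul_eq_of_mem_span_singleton hc x.2)))
  · obtain ⟨_, x, rfl⟩ := x
    exact (mul_smul c c x).symm.trans (congrArg (· • x) hc.eq)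

theorem projective_fun {P : Type*} [AddCommGroup P] [Module A P] [Module.Projective A P] (n : ℕ) :
    Module.Projective A (Fin n → P) :=
  .of_equiv (DFinsupp.linearEquivFunOnFintype (R := A) (M := fun _ : Fin n => P))

theorem natCard_linearMap_pi {P : Type*} [AddCommGroup P] [Module A P] (n : ℕ) :
    Nat.card ((Fin n → P) →ₗ[A] M) = Nat.card (P →ₗ[A] M) ^ n := by
  rw [Nat.card_congr (LinearMap.lsum A (fun _ : Fin n => P) ℕ).toEquiv.symm, Nat.card_fun,
    Nat.card_fin]

variable {C : Type*} [Ring C] (f : A →+* C)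

/-- The map that a ring homomorphism `f` induces between the left ideals generated by `c` and
by `f c`. -/
def mapSpanSingleton (c : A) : Ideal.span {c} →ₛₗ[f] Ideal.span {f c} where
  toFun x := ⟨f x, by
    have h := Ideal.mem_map_of_mem f x.2
    rwa [Ideal.map_span, Set.image_singleton] at h⟩
  map_add' x y := Subtype.ext (map_add f x.1 y.1)
  map_smul' a x := Subtype.ext (map_mul f a x.1)

variable {f}

theorem isLatticeEmbedding_mapSpanSingleton
    (hf : ∀ v : C, ∃ m : ℕ, m ≠ 0 ∧ m • v ∈ Set.range f)
    (hc : ∀ x ∈ Ideal.span {c}, f x = 0 → x = 0) : IsLatticeEmbedding (mapSpanSingleton f c) where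
  injective := (injective_iff_map_eq_zero _).mpr fun x hx =>
    Subtype.ext (hc x x.2 (congrArg Subtype.val hx))
  exists_nsmul_mem_range := by
    rintro ⟨_, hv⟩
    obtain ⟨w, rfl⟩ := Ideal.mem_span_singleton'.mp hv
    obtain ⟨m, hm, x, hx⟩ := hf w
    refine ⟨m, hm, ⟨x * c, Ideal.mul_mem_left _ x (Ideal.mem_span_singleton_self c)⟩,
      Subtype.ext ?_⟩
    change f (x * c) = m • (w * f c)
    rw [map_mul, hx, smul_mul_assoc]

theorem natCard_range_smul_pow_eq (hA : IsSemisimpleModPrimes A) [IsAddTorsionFree C] {a c : A}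
    (ha : IsIdempotentElem a) (hc : IsIdempotentElem c)
    (hf : ∀ v : C, ∃ m : ℕ, m ≠ 0 ∧ m • v ∈ Set.range f)
    (hfa : ∀ x ∈ Ideal.span {a}, f x = 0 → x = 0) (hfc : ∀ x ∈ Ideal.span {c}, f x = 0 → x = 0)
    {n r : ℕ} (θ : (Fin n → Ideal.span {f c}) ≃ₗ[C] (Fin r → Ideal.span {f a})) [Finite M] :
    Nat.card (DistribSMul.toAddMonoidHom M c).range ^ n =
      Nat.card (DistribSMul.toAddMonoidHom M a).range ^ r := by
  have := projective_span_singleton ha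
  have := projective_span_singleton hc
  have : IsAddTorsionFree (Ideal.span {f a}) := Function.Injective.isAddTorsionFree
    (Ideal.span {f a}).subtype.toAddMonoidHom (Ideal.span {f a}).subtype_injective
  have := projective_fun (A := A) (P := Ideal.span {a}) r
  have := projective_fun (A := A) (P := Ideal.span {c}) n
  rw [← natCard_linearMap_span_singleton ha, ← natCard_linearMap_span_singleton hc,
    ← natCard_linearMap_pi, ← natCard_linearMap_pi]
  exact IsLatticeEmbedding.natCard_linearMap_eq hA
    (((isLatticeEmbedding_mapSpanSingleton hf hfc).piMapₛₗ n).comp_linearEquiv θ)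
    ((isLatticeEmbedding_mapSpanSingleton hf hfa).piMapₛₗ r) M

end IdempotentIdeals

end HomCounting

section Integrality

variable {A : Type*} [Ring A]

theorem IsSemisimpleModPrimes.mem_span_of_mul_self_mem (hA : IsSemisimpleModPrimes A) {p : ℕ}
    (hp : p.Prime) {y : A} (hy : y ∈ Set.center A) (hyy : y * y ∈ Ideal.span {(p : A)}) :
    y ∈ Ideal.span {(p : A)} := by
  have := hA p hp
  let π := (Ideal.span {(p : A)}).mkQ
  obtain ⟨N, hN⟩ := ComplementedLattice.exists_isCompl (Submodule.map π (Ideal.span {y}))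
  have hy_mem (z : A ⧸ Ideal.span {(p : A)}) : y • z ∈ Submodule.map π (Ideal.span {y}) := by
    obtain ⟨a, rfl⟩ := Submodule.mkQ_surjective _ z
    exact ⟨y * a, Ideal.mem_span_singleton'.mpr ⟨a, (hy.comm a).eq.symm⟩, rfl⟩
  have hy_image {z} (hz : z ∈ Submodule.map π (Ideal.span {y})) : y • z = 0 := by
    obtain ⟨_, hx, rfl⟩ := hz
    obtain ⟨a, rfl⟩ := Ideal.mem_span_singleton'.mp hx
    refine (Submodule.Quotient.mk_eq_zero _).mpr ?_
    change y * (a * y) ∈ _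
    rw [← mul_assoc, (hy.comm a).eq, mul_assoc]
    exact Ideal.mul_mem_left _ a hyy
  have hy_compl {z} (hz : z ∈ N) : y • z = 0 :=
    Submodule.disjoint_def.mp hN.disjoint _ (hy_mem z) (N.smul_mem y hz)
  obtain ⟨z, hz, z', hz', hzz'⟩ :=
    Submodule.mem_sup.mp (hN.sup_eq_top ▸ Submodule.mem_top : π 1 ∈ _ ⊔ N)
  have h : y • π 1 = 0 := by rw [← hzz', smul_add, hy_image hz, hy_compl hz', add_zero]
  rw [← map_smul, smul_eq_mul, mul_one] at h
  exact (Submodule.Quotient.mk_eq_zero _).mp h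

/-- An element `y` with `f y = m e` satisfies `y² = m y`, so that `IsSemisimpleModPrimes` divides
`y` by the primes dividing `m`. -/
theorem IsSemisimpleModPrimes.exists_map_eq (hA : IsSemisimpleModPrimes A) {B : Type*} [Ring B]
    [IsAddTorsionFree B] {f : A →+* B} (hf : Function.Injective f)
    {e : B} (he : IsIdempotentElem e) (hec : e ∈ Set.center B) {m : ℕ} (hm : m ≠ 0) :
    ∀ y : A, f y = m • e → ∃ r : A, f r = e := by
  induction m using induction_on_primes with
  | zero => exact absurd rfl hm
  | one => exact fun y hy => ⟨y, by simpa using hy⟩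
  | prime_mul p a hp ih =>
    intro y hy
    have hyc : y ∈ Set.center A := Semigroup.mem_center_iff.mpr fun x => hf (by
      rw [map_mul, map_mul, hy, mul_smul_comm, smul_mul_assoc, (hec.comm (f x)).eq])
    have hyy : y * y = (p * a) • y := hf (by
      rw [map_mul, map_nsmul, hy, smul_mul_smul_comm, he.eq, smul_smul])
    obtain ⟨x, hx⟩ := Ideal.mem_span_singleton'.mp (hA.mem_span_of_mul_self_mem hp hyc (by
      rw [hyy, nsmul_eq_mul, mul_comm p, Nat.cast_mul, mul_assoc, (Nat.cast_commute p y).eq,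
        ← mul_assoc]
      exact Ideal.mul_mem_left _ _ (Ideal.mem_span_singleton_self _)))
    refine ih (right_ne_zero_of_mul hm) x (nsmul_right_injective hp.ne_zero ?_)
    dsimp only
    rw [smul_smul, ← hy, ← hx, map_mul, map_natCast, nsmul_eq_mul, (Nat.cast_commute p (f x)).eq]

end Integrality

section GroupRingModPrimes

variable {Γ : Type*} [Group Γ] {R : Type*} [CommRing R]

theorem ker_mapRingHom_quotient (p : R) :
    RingHom.ker (MonoidAlgebra.mapRingHom Γ (Ideal.Quotient.mk (Ideal.span {p}))) =
      Ideal.span {MonoidAlgebra.single 1 p} := by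
  refine le_antisymm (fun x hx => ?_) ?_
  · have hcoeff (g : Γ) : x.coeff g ∈ Ideal.span {p} := by
      rw [← Ideal.Quotient.eq_zero_iff_mem, ← MonoidAlgebra.coeff_mapRingHom,
        RingHom.mem_ker.mp hx]
      rfl
    rw [← MonoidAlgebra.sum_coeff_single x]
    refine Submodule.sum_mem _ fun g _ => ?_
    obtain ⟨c, hc⟩ := Ideal.mem_span_singleton'.mp (hcoeff g)
    exact Ideal.mem_span_singleton'.mpr ⟨.single g c, by
      rw [MonoidAlgebra.single_mul_single, mul_one, hc]⟩
  · rw [Ideal.span_singleton_le_iff_mem, RingHom.mem_ker, MonoidAlgebra.mapRingHom_single,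
      Ideal.Quotient.eq_zero_iff_mem.mpr (Ideal.mem_span_singleton_self p),
      MonoidAlgebra.single_zero]

theorem isSemisimpleModPrimes_monoidAlgebra [Finite Γ] (hΓ : IsUnit (Nat.card Γ : R))
    (hR : ∀ p : ℕ, p.Prime → ¬ IsUnit (p : R) → (Ideal.span {(p : R)}).IsMaximal) :
    IsSemisimpleModPrimes (MonoidAlgebra R Γ) := by
  intro p hp
  by_cases hu : IsUnit (p : R)
  · have h : (Ideal.span {(p : MonoidAlgebra R Γ)} : Ideal _) = ⊤ :=
      Ideal.eq_top_of_isUnit_mem _ (Ideal.mem_span_singleton_self _)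
        (by simpa using hu.map (algebraMap R (MonoidAlgebra R Γ)))
    have := Submodule.Quotient.subsingleton_iff.mpr h
    exact (isSemisimpleModule_iff _ _).mpr
      ⟨fun N => ⟨N, .of_eq (Subsingleton.elim _ _) (Subsingleton.elim _ _)⟩⟩
  have := hR p hp hu
  let _ : Field (R ⧸ Ideal.span {(p : R)}) := Ideal.Quotient.field _
  let f := MonoidAlgebra.mapRingHom Γ (Ideal.Quotient.mk (Ideal.span {(p : R)}))
  have : NeZero (Nat.card Γ : R ⧸ Ideal.span {(p : R)}) :=
    ⟨by simpa using (hΓ.map (Ideal.Quotient.mk (Ideal.span {(p : R)}))).ne_zero⟩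
  have hker : RingHom.ker f = Ideal.span {(p : MonoidAlgebra R Γ)} :=
    ker_mapRingHom_quotient (p : R)
  let l := (Ideal.span {(p : MonoidAlgebra R Γ)}).liftQ f.toSemilinearMap hker.ge
  have hf : Function.Surjective f := MonoidAlgebra.map_surjective _ Ideal.Quotient.mk_surjective
  have : RingHomSurjective f := ⟨hf⟩
  have hl : Function.Bijective l := ⟨by
    rw [← LinearMap.ker_eq_bot]
    exact Submodule.ker_liftQ_eq_bot _ _ _ hker.le, fun x =>
    let ⟨y, hy⟩ := hf x
    ⟨Submodule.Quotient.mk y, hy⟩⟩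
  exact (LinearMap.isSemisimpleModule_iff_of_bijective l hl).mpr inferInstance

theorem isMaximal_span_natCast [Algebra ℤ R] (M : Submonoid ℤ) [IsLocalization M R] {p : ℕ}
    (hp : p.Prime) (hu : ¬ IsUnit (p : R)) : (Ideal.span {(p : R)}).IsMaximal := by
  have hmap : Ideal.span {(p : R)} = (Ideal.span {(p : ℤ)}).map (algebraMap ℤ R) := by
    rw [Ideal.map_span, Set.image_singleton, map_natCast]
  have : (Ideal.span {(p : ℤ)}).IsMaximal :=
    PrincipalIdealRing.isMaximal_of_irreducible (Nat.prime_iff_prime_int.mp hp).irreducible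
  refine Ideal.isMaximal_def.mpr ⟨by rwa [ne_eq, Ideal.span_singleton_eq_top], fun J hJ => ?_⟩
  by_contra hne
  have hle : Ideal.span {(p : ℤ)} ≤ J.under ℤ := Ideal.map_le_iff_le_comap.mp (hmap ▸ hJ.le)
  refine hJ.ne ?_
  rw [hmap, this.eq_of_le (Ideal.comap_ne_top _ hne) hle, IsLocalization.map_under M]

end GroupRingModPrimes

section SimpleCorner

theorem mem_center_of_isTwoSided_span {A : Type*} [Ring A] [IsSemisimpleRing A] {c : A}
    (hc : IsIdempotentElem c) (h : (Ideal.span {c}).IsTwoSided) : c ∈ Set.center A := by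
  have hright (x : A) : c * x * c = c * x := by
    obtain ⟨y, hy⟩ := Ideal.mem_span_singleton'.mp
      ((Ideal.span {c}).mul_mem_right x (Ideal.mem_span_singleton_self c))
    rw [← hy, mul_assoc, hc.eq]
  have hleft (x : A) : c * x * c = x * c := by
    set z := c * x * c - x * c with hz
    have hcz (u : A) : c * u * z = 0 := by
      rw [hz, mul_sub, ← mul_assoc, ← mul_assoc, hright, ← mul_assoc, sub_self]
    have hzc : z * c = z := by rw [hz, sub_mul, mul_assoc, mul_assoc x, hc.eq]
    obtain ⟨d, hd, hspan⟩ := IsSemisimpleRing.ideal_eq_span_idempotent (Ideal.span {z})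
    obtain ⟨u, hu⟩ := Ideal.mem_span_singleton'.mp (hspan ▸ Ideal.mem_span_singleton_self d)
    have hd0 : d = 0 := by
      rw [← hd.eq, ← hu]
      calc u * z * (u * z) = u * (z * c) * (u * z) := by rw [hzc]
        _ = u * z * (c * u * z) := by simp only [mul_assoc]
        _ = 0 := by rw [hcz, mul_zero]
    rw [hd0, Ideal.span_singleton_eq_bot.mpr rfl, Ideal.span_singleton_eq_bot] at hspan
    exact sub_eq_zero.mp hspan
  exact Semigroup.mem_center_iff.mpr fun x => by rw [← hleft, hright]

variable {A : Type*} [Ring A] {e : A}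

/-- The ring homomorphism `x ↦ ex` onto the ring `eA`, for a central idempotent `e`. -/
def toCorner (he : IsIdempotentElem e) (hc : e ∈ Set.center A) : A →+* he.Corner where
  toFun x := ⟨e * x, (Subsemigroup.mem_corner_iff he).mpr
    ⟨by rw [← mul_assoc, he.eq], by rw [(hc.comm x).eq, mul_assoc, he.eq]⟩⟩
  map_one' := Subtype.ext (mul_one e)
  map_mul' x y := Subtype.ext <| by
    change e * (x * y) = e * x * (e * y)
    rw [mul_assoc, ← mul_assoc x, ← (hc.comm x).eq, mul_assoc e x y, ← mul_assoc e e, he.eq]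
  map_zero' := Subtype.ext (mul_zero e)
  map_add' x y := Subtype.ext (mul_add e x y)

theorem toCorner_coe (he : IsIdempotentElem e) (hc : e ∈ Set.center A) (x : he.Corner) :
    toCorner he hc (x.1 : A) = x :=
  Subtype.ext ((Subsemigroup.mem_corner_iff he).mp x.2).1

theorem IsIrredCentralIdem.isSimpleRing_corner [IsSemisimpleRing A] (he : IsIrredCentralIdem e) :
    IsSimpleRing he.idem.Corner := by
  let π := toCorner he.idem he.central
  have hπ : Function.Surjective π := fun x => ⟨x.1, toCorner_coe _ _ x⟩
  have := π.isSemisimpleRing_of_surjective hπ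
  refine isSimpleRing_iff_isTwoSided_imp.mpr
    ⟨⟨0, 1, fun h => he.ne_zero (congrArg Subtype.val h).symm⟩, fun I hI => ?_⟩
  obtain ⟨c, hc, rfl⟩ := IsSemisimpleRing.ideal_eq_span_idempotent I
  have hcc := mem_center_of_isTwoSided_span hc hI
  have hce : c.1 ∈ Set.center A := Semigroup.mem_center_iff.mpr fun x => by
    obtain ⟨hec, hce⟩ := (Subsemigroup.mem_corner_iff he.idem).mp c.2
    have h : c.1 * (e * x) = e * x * c.1 := congrArg Subtype.val (hcc.comm (π x)).eq
    rw [← hec, ← mul_assoc, ← (he.central.comm x).eq, ← h, hec, ← mul_assoc, hce]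
  rcases he.irred c.1 (congrArg Subtype.val hc.eq) hce
    ((Subsemigroup.mem_corner_iff he.idem).mp c.2).2 with h | h
  · exact .inl (Ideal.span_singleton_eq_bot.mpr (Subtype.ext h))
  · exact .inr (Ideal.eq_top_iff_one _ |>.mpr
      ((Subtype.ext h : c = 1) ▸ Ideal.mem_span_singleton_self c))

end SimpleCorner

section CentralSimple

open scoped TensorProduct

variable {K C : Type*} [Field K] [Ring C] [Algebra K C]

attribute [local instance] instModuleTensorProductMop

theorem tmul_op_one_smul (a x : C) : (a ⊗ₜ[K] MulOpposite.op 1 : C ⊗[K] Cᵐᵒᵖ) • x = a * x :=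
  (AlgHom.mulLeftRight_apply K C a _ x).trans (mul_one _)

theorem one_tmul_op_smul (b x : C) : ((1 : C) ⊗ₜ[K] MulOpposite.op b : C ⊗[K] Cᵐᵒᵖ) • x = x * b :=
  (AlgHom.mulLeftRight_apply K C 1 _ x).trans (by rw [one_mul, MulOpposite.unop_op])

instance isSimpleModule_tensorProduct_mulOpposite [IsSimpleRing C] :
    IsSimpleModule (C ⊗[K] Cᵐᵒᵖ) C := by
  refine (isSimpleModule_iff _ _).mpr { eq_bot_or_eq_top := fun N => ?_ }
  let I : Ideal C :=
    { N.toAddSubmonoid with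
      smul_mem' := fun a x hx => (tmul_op_one_smul (K := K) a x ▸ N.smul_mem _ hx : a * x ∈ N) }
  have hI : I.IsTwoSided := ⟨fun b hx => one_tmul_op_smul (K := K) b _ ▸ N.smul_mem _ hx⟩
  rcases (isSimpleRing_iff_isTwoSided_imp.mp ‹IsSimpleRing C›).2 I hI with h | h
  · exact .inl (SetLike.ext fun x => (SetLike.ext_iff.mp h x :))
  · exact .inr (SetLike.ext fun x => (SetLike.ext_iff.mp h x :))

theorem exists_end_apply_eq_smul [Algebra.IsCentral K C] (φ : Module.End (C ⊗[K] Cᵐᵒᵖ) C) :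
    ∃ k : K, ∀ x, φ x = k • x := by
  have hleft (x : C) : φ x = x * φ 1 := by
    rw [← tmul_op_one_smul (K := K), ← map_smul, tmul_op_one_smul, mul_one]
  have hright (x : C) : φ x = φ 1 * x := by
    rw [← one_tmul_op_smul (K := K), ← map_smul, one_tmul_op_smul, one_mul]
  obtain ⟨k, hk⟩ := Algebra.IsCentral.mem_center_iff K |>.mp
    (Subalgebra.mem_center_iff.mpr fun x => (hleft x).symm.trans (hright x))
  exact ⟨k, fun x => by rw [hright, hk, Algebra.smul_def]⟩

theorem exists_mulLeftRight_eq_ite [IsSimpleRing C] [Algebra.IsCentral K C] {ι : Type*}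
    [DecidableEq ι] {v : ι → C} (hv : LinearIndependent K v) (s : Finset ι) (i : ι) :
    ∃ t : C ⊗[K] Cᵐᵒᵖ, ∀ j ∈ s, AlgHom.mulLeftRight K C t (v j) = if j = i then 1 else 0 := by
  classical
  obtain ⟨q, hq⟩ := LinearMap.exists_leftInverse_of_injective (Finsupp.linearCombination K v)
    (LinearMap.ker_eq_bot.mpr hv)
  have hqj (j : ι) : q (v j) = Finsupp.single j 1 := by
    simpa using LinearMap.congr_fun hq (Finsupp.single j 1)
  let f : Module.End (Module.End (C ⊗[K] Cᵐᵒᵖ) C) C :=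
    { toFun x := algebraMap K C (q x i)
      map_add' x y := by simp
      map_smul' φ x := by
        obtain ⟨k, hk⟩ := exists_end_apply_eq_smul φ
        change algebraMap K C (q (φ x) i) = φ (algebraMap K C (q x i))
        rw [hk, hk, map_smul, Finsupp.smul_apply, smul_eq_mul, map_mul, ← Algebra.smul_def] }
  obtain ⟨t, ht⟩ := jacobson_density f (s.image v)
  refine ⟨t, fun j hj => (ht _ (Finset.mem_image_of_mem v hj)).symm.trans ?_⟩
  change algebraMap K C (q (v j) i) = _
  rw [hqj, Finsupp.single_apply, apply_ite (algebraMap K C), map_one, map_zero]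

variable {L B : Type*} [Field L] [Ring B] [Algebra L B]

theorem exists_linearMap_map_mulLeftRight (g : C →+* B) (t : C ⊗[K] Cᵐᵒᵖ) :
    ∃ T : B →ₗ[L] B, ∀ x, T (g x) = g (AlgHom.mulLeftRight K C t x) := by
  induction t with
  | zero =>
    exact ⟨0, fun x => by rw [map_zero, LinearMap.zero_apply, LinearMap.zero_apply, map_zero]⟩
  | tmul a b =>
    exact ⟨LinearMap.mulLeft L (g a) ∘ₗ LinearMap.mulRight L (g b.unop), fun x => by
      rw [AlgHom.mulLeftRight_apply, map_mul, map_mul, mul_assoc]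
      rfl⟩
  | add t t' ht ht' =>
    obtain ⟨T, hT⟩ := ht
    obtain ⟨T', hT'⟩ := ht'
    exact ⟨T + T', fun x => by
      rw [map_add, LinearMap.add_apply, LinearMap.add_apply, map_add, hT, hT']⟩

theorem linearIndependent_map_of_isSimpleRing [IsSimpleRing C] [Algebra.IsCentral K C]
    [Nontrivial B] (g : C →+* B) {ι : Type*} {v : ι → C} (hv : LinearIndependent K v) :
    LinearIndependent L (g ∘ v) := by
  classical
  refine linearIndependent_iff'.mpr fun s l hl i hi => ?_
  obtain ⟨t, ht⟩ := exists_mulLeftRight_eq_ite hv s i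
  obtain ⟨T, hT⟩ := exists_linearMap_map_mulLeftRight (L := L) g t
  have h : ∑ j ∈ s, l j • g (if j = i then 1 else 0) = 0 := by
    rw [← map_zero T, ← hl, map_sum]
    exact Finset.sum_congr rfl fun j hj => by rw [map_smul, Function.comp_apply, hT, ht j hj]
  simpa [apply_ite g, hi] using h

end CentralSimple

section EndDimension

theorem finrank_range_lcomp {L V : Type*} [Field L] [AddCommGroup V] [Module L V]
    [FiniteDimensional L V] (P : Module.End L V) :
    Module.finrank L (LinearMap.range (LinearMap.lcomp L V P)) =
      Module.finrank L V * Module.finrank L (LinearMap.range P) := by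
  have hrange : LinearMap.range (LinearMap.lcomp L V P) =
      LinearMap.range (LinearMap.lcomp L V P.rangeRestrict) := by
    refine le_antisymm ?_ ?_
    · rintro _ ⟨T, rfl⟩
      exact ⟨T ∘ₗ (LinearMap.range P).subtype, rfl⟩
    · rintro _ ⟨T, rfl⟩
      obtain ⟨T', rfl⟩ := T.exists_extend
      exact ⟨T', rfl⟩
  have hinj : Function.Injective (LinearMap.lcomp L V P.rangeRestrict) := fun T T' h =>
    LinearMap.ext fun x => by
      obtain ⟨y, rfl⟩ := P.surjective_rangeRestrict x
      exact LinearMap.congr_fun h y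
  rw [hrange, LinearMap.finrank_range_of_inj hinj, Module.finrank_linearMap, mul_comm]

variable {K C L V : Type*} [Field K] [Ring C] [Algebra K C] [Field L] [AddCommGroup V] [Module L V]

theorem exists_map_algebraMap_eq_smul {g : C →+* Module.End L V}
    (hg : Submodule.span L (Set.range g) = ⊤) (k : K) :
    ∃ l : L, g (algebraMap K C k) = algebraMap L _ l := by
  refine Algebra.IsCentral.mem_center_iff L |>.mp (Subalgebra.mem_center_iff.mpr fun T => ?_)
  induction (hg ▸ Submodule.mem_top : T ∈ Submodule.span L (Set.range g))
    using Submodule.span_induction with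
  | mem _ h =>
    obtain ⟨x, rfl⟩ := h
    rw [← map_mul, ← map_mul, Algebra.commutes]
  | zero => rw [zero_mul, mul_zero]
  | add T T' _ _ h h' => rw [add_mul, mul_add, h, h']
  | smul l T _ h => rw [smul_mul_assoc, mul_smul_comm, h]

variable [Algebra.IsCentral K C] [IsSimpleRing C] [FiniteDimensional K C] [Nontrivial V]
  {g : C →+* Module.End L V}

theorem finrank_span_image_eq (hg : Submodule.span L (Set.range g) = ⊤) (W : Submodule K C) :
    Module.finrank L (Submodule.span L (g '' W)) = Module.finrank K W := by
  let b := Module.finBasis K W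
  have hb : LinearIndependent K fun i => (b i : C) :=
    b.linearIndependent.map' W.subtype W.ker_subtype
  have hspan :
      Submodule.span L (g '' W) = Submodule.span L (Set.range (g ∘ fun i => (b i : C))) := by
    refine le_antisymm (Submodule.span_le.mpr ?_) (Submodule.span_mono ?_)
    · rintro _ ⟨x, hx, rfl⟩
      have hsum : x = ∑ i, b.repr ⟨x, hx⟩ i • (b i : C) := by
        have h := congrArg W.subtype (b.sum_repr ⟨x, hx⟩)
        simpa only [map_sum, map_smul, Submodule.subtype_apply] using h.symm
      rw [hsum, map_sum]
      refine Submodule.sum_mem _ fun i _ => ?_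
      obtain ⟨l, hl⟩ := exists_map_algebraMap_eq_smul hg (b.repr ⟨x, hx⟩ i)
      rw [Algebra.smul_def, map_mul, hl, ← Algebra.smul_def]
      exact Submodule.smul_mem _ _ (Submodule.subset_span ⟨i, rfl⟩)
    · rintro _ ⟨i, rfl⟩
      exact ⟨b i, (b i).2, rfl⟩
  rw [hspan, finrank_span_eq_card (linearIndependent_map_of_isSimpleRing g hb), Fintype.card_fin]

theorem finrank_span_singleton_eq_mul [FiniteDimensional L V]
    (hg : Submodule.span L (Set.range g) = ⊤) (c : C) :
    Module.finrank K (Ideal.span {c}) =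
      Module.finrank L V * Module.finrank L (LinearMap.range (g c)) := by
  have himage : g '' (Ideal.span {c}) = LinearMap.lcomp L V (g c) '' Set.range g := by
    ext T
    constructor
    · rintro ⟨x, hx, rfl⟩
      obtain ⟨y, rfl⟩ := Ideal.mem_span_singleton'.mp hx
      exact ⟨g y, ⟨y, rfl⟩, (map_mul g y c).symm⟩
    · rintro ⟨_, ⟨y, rfl⟩, rfl⟩
      exact ⟨y * c, Ideal.mem_span_singleton'.mpr ⟨y, rfl⟩, map_mul g y c⟩
  rw [← finrank_range_lcomp, ← Submodule.map_top, ← hg, Submodule.map_span, ← himage]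
  exact (finrank_span_image_eq hg ((Ideal.span {c}).restrictScalars K)).symm

theorem finrank_eq_sq [FiniteDimensional L V] (hg : Submodule.span L (Set.range g) = ⊤) :
    Module.finrank K C = Module.finrank L V ^ 2 := by
  have h := finrank_span_singleton_eq_mul (K := K) hg 1
  have hrange : LinearMap.range (g 1) = ⊤ := by rw [map_one]; exact LinearMap.range_id
  rw [hrange, finrank_top, ← sq, Ideal.span_singleton_one] at h
  rw [← h]
  exact (finrank_top K C).symm

end EndDimension

section Isotypic

theorem isIsotypicOfType_of_isSimpleRing {C : Type*} [Ring C] [IsSimpleRing C] [IsArtinianRing C]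
    (M S : Type*) [AddCommGroup M] [Module C M] [AddCommGroup S] [Module C S] [IsSimpleModule C S] :
    IsIsotypicOfType C M S := by
  let e : S ≃ₗ[C] LinearMap.range (LinearMap.inr C M S) :=
    .ofInjective _ LinearMap.inr_injective
  have := IsSimpleModule.congr e.symm
  exact ((IsSimpleRing.isIsotypic C (M × S) (LinearMap.range (LinearMap.inr C M S))).of_injective
    (LinearMap.inl C M S) LinearMap.inl_injective).of_linearEquiv_type e.symm

theorem nonempty_linearEquiv_of_finrank_eq {K C M N : Type*} [Field K] [Ring C] [Algebra K C]
    [IsSimpleRing C] [FiniteDimensional K C] [AddCommGroup M] [Module C M] [Module K M]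
    [IsScalarTower K C M] [Module.Finite C M] [AddCommGroup N] [Module C N] [Module K N]
    [IsScalarTower K C N] [Module.Finite C N]
    (h : Module.finrank K M = Module.finrank K N) : Nonempty (M ≃ₗ[C] N) := by
  have := IsArtinianRing.of_finite K C
  obtain ⟨S, hS⟩ := IsAtomic.exists_atom (Ideal C)
  have := isSimpleModule_iff_isAtom.mpr hS
  have := IsSimpleModule.nontrivial C S
  obtain ⟨m, ⟨e⟩⟩ := (isIsotypicOfType_of_isSimpleRing (C := C) M S).linearEquiv_fun
  obtain ⟨n, ⟨e'⟩⟩ := (isIsotypicOfType_of_isSimpleRing (C := C) N S).linearEquiv_fun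
  have : FiniteDimensional K S := inferInstanceAs (FiniteDimensional K (S.restrictScalars K))
  rw [(e.restrictScalars K).finrank_eq, (e'.restrictScalars K).finrank_eq,
    Module.finrank_pi_fintype, Module.finrank_pi_fintype, Finset.sum_const, Finset.sum_const,
    Finset.card_fin, Finset.card_fin, smul_eq_mul, smul_eq_mul,
    Nat.mul_right_cancel_iff Module.finrank_pos] at h
  subst h
  exact ⟨e.trans e'.symm⟩

theorem nonempty_linearEquiv_pi_span_singleton {K C L V : Type*} [Field K] [Ring C] [Algebra K C]
    [Algebra.IsCentral K C] [IsSimpleRing C] [FiniteDimensional K C] [Field L] [AddCommGroup V]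
    [Module L V] [FiniteDimensional L V] [Nontrivial V] {g : C →+* Module.End L V}
    (hg : Submodule.span L (Set.range g) = ⊤) (c : C) :
    Nonempty ((Fin (Module.finrank L V) → Ideal.span {c}) ≃ₗ[C]
      (Fin (Module.finrank L (LinearMap.range (g c))) → C)) := by
  refine nonempty_linearEquiv_of_finrank_eq (K := K) ?_
  simp only [Module.finrank_pi_fintype, finrank_span_singleton_eq_mul hg, finrank_eq_sq hg,
    Finset.sum_const, Finset.card_fin, smul_eq_mul]
  ring

end Isotypic

section CentralIdempotents

variable {A : Type*} [Ring A]

theorem exists_isIrredCentralIdem_mul_eq [IsArtinianRing A] {t : A} (ht : IsIdempotentElem t)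
    (htc : t ∈ Set.center A) (ht0 : t ≠ 0) : ∃ f : A, IsIrredCentralIdem f ∧ f * t = f := by
  obtain ⟨f, ⟨hf, hfc, hf0, hft⟩, hmin⟩ := exists_minimalFor_of_wellFoundedLT
    (fun f : A => IsIdempotentElem f ∧ f ∈ Set.center A ∧ f ≠ 0 ∧ f * t = f)
    (fun f => Ideal.span {f}) ⟨t, ht, htc, ht0, ht.eq⟩
  refine ⟨f, ⟨hf, hfc, hf0, fun g hg hgc hgf => or_iff_not_imp_left.mpr fun hg0 => ?_⟩, hft⟩
  have hle : Ideal.span {f} ≤ Ideal.span {g} :=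
    hmin ⟨hg, hgc, hg0, by rw [← hgf, mul_assoc, hft]⟩
      ((Ideal.span_singleton_le_iff_mem _).mpr (Ideal.mem_span_singleton'.mpr ⟨g, hgf⟩))
  obtain ⟨x, hx⟩ := Ideal.mem_span_singleton'.mp (hle (Ideal.mem_span_singleton_self f))
  calc g = f * g := by rw [(hfc.comm g).eq, hgf]
    _ = f := by rw [← hx, mul_assoc, hg.eq]

theorem completeOrthogonalIdempotents_irredCentralIdem [IsArtinianRing A]
    [Fintype {e : A // IsIrredCentralIdem e}] :
    CompleteOrthogonalIdempotents fun e : {e : A // IsIrredCentralIdem e} => e.1 := by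
  have hortho : OrthogonalIdempotents fun e : {e : A // IsIrredCentralIdem e} => e.1 :=
    { idem e := e.2.idem
      ortho e f h := e.2.mul_eq_zero f.2 fun h' => h (Subtype.ext h') }
  refine ⟨hortho, ?_⟩
  by_contra hne
  obtain ⟨f, hf, hfs⟩ := exists_isIrredCentralIdem_mul_eq hortho.isIdempotentElem_sum.one_sub
    ((Subring.center A).sub_mem (Subring.center A).one_mem
      ((Subring.center A).sum_mem fun e _ => e.2.central)) (sub_ne_zero.mpr (Ne.symm hne))
  have hf1 : f * ∑ e : {e : A // IsIrredCentralIdem e}, e.1 = f :=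
    hortho.mul_sum_of_mem (Finset.mem_univ (⟨f, hf⟩ : {e : A // IsIrredCentralIdem e}))
  rw [mul_sub, mul_one, hf1, sub_self] at hfs
  exact hf.ne_zero hfs.symm

end CentralIdempotents

section SubgroupIdempotents

open MonoidAlgebra (single)

variable {R : Type*} [CommRing R] {Γ : Type*} [Group Γ] [Fintype Γ]

open Classical in
/-- The idempotent `|Δ|⁻¹ ∑_{δ ∈ Δ} δ` of `R[Γ]` which projects onto the `Δ`-invariants. Like `e₁`,
it is only meaningful when `|Δ|` is a unit of `R`. -/
def subgroupIdem (R : Type*) [CommRing R] (Δ : Subgroup Γ) : MonoidAlgebra R Γ :=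
  Ring.inverse (Nat.card Δ : R) • ∑ δ : Δ, single δ.1 1

theorem subgroupIdem_top : subgroupIdem R (⊤ : Subgroup Γ) = e₁ Γ R := by
  classical
  rw [subgroupIdem, e₁, Subgroup.card_top, Nat.card_eq_fintype_card]
  exact congrArg _ (Fintype.sum_equiv Subgroup.topEquiv.toEquiv _ _ fun _ => rfl)

variable {Δ : Subgroup Γ}

theorem single_mul_subgroupIdem {g : Γ} (hg : g ∈ Δ) :
    single g 1 * subgroupIdem R Δ = subgroupIdem R Δ := by
  classical
  rw [subgroupIdem, mul_smul_comm, Finset.mul_sum]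
  congr 1
  exact Fintype.sum_equiv (Equiv.mulLeft ⟨g, hg⟩) _ _ fun x => by
    simp [MonoidAlgebra.single_mul_single]

theorem subgroupIdem_smul_eq_self {M : Type*} [AddCommGroup M] [Module (MonoidAlgebra R Γ) M]
    (hΔ : IsUnit (Nat.card Δ : R)) {x : M}
    (hx : ∀ g ∈ Δ, (single g 1 : MonoidAlgebra R Γ) • x = x) : subgroupIdem R Δ • x = x := by
  classical
  rw [subgroupIdem, Algebra.smul_def, mul_smul, Finset.sum_smul,
    Finset.sum_congr rfl fun δ _ => hx δ.1 δ.2, Finset.sum_const, Finset.card_univ,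
    ← Nat.card_eq_fintype_card, ← Nat.cast_smul_eq_nsmul (MonoidAlgebra R Γ), smul_smul,
    ← map_natCast (algebraMap R (MonoidAlgebra R Γ)), ← map_mul, Ring.inverse_mul_cancel _ hΔ,
    map_one, one_smul]

theorem isIdempotentElem_subgroupIdem (hΔ : IsUnit (Nat.card Δ : R)) :
    IsIdempotentElem (subgroupIdem R Δ) :=
  subgroupIdem_smul_eq_self hΔ fun _ hg => single_mul_subgroupIdem hg

theorem mapRingHom_subgroupIdem {R' : Type*} [CommRing R'] (f : R →+* R')
    (hΔ : IsUnit (Nat.card Δ : R)) :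
    MonoidAlgebra.mapRingHom Γ f (subgroupIdem R Δ) = subgroupIdem R' Δ := by
  classical
  obtain ⟨u, hu⟩ := hΔ
  have hinv : f (Ring.inverse (Nat.card Δ : R)) = Ring.inverse (Nat.card Δ : R') := by
    rw [← map_natCast f, ← hu, Ring.inverse_unit]
    exact (Ring.inverse_unit (Units.map f.toMonoidHom u)).symm
  ext g
  rw [subgroupIdem, subgroupIdem, ← hinv]
  simp [MonoidAlgebra.coeff_sum, Finsupp.single_apply]

end SubgroupIdempotents

section GroupAlgebra

open MonoidAlgebra (single)

theorem isIrredCentralIdem_e₁ {k Γ : Type*} [Field k] [Group Γ] [Fintype Γ]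
    (hΓ : IsUnit (Nat.card Γ : k)) : IsIrredCentralIdem (e₁ Γ k) := by
  have hsingle (g : Γ) : single g 1 * e₁ Γ k = e₁ Γ k := by
    rw [← subgroupIdem_top, single_mul_subgroupIdem (Subgroup.mem_top g)]
  have hidem : IsIdempotentElem (e₁ Γ k) := by
    rw [← subgroupIdem_top]
    exact isIdempotentElem_subgroupIdem (by rwa [Subgroup.card_top])
  have hne : e₁ Γ k ≠ 0 := by
    classical
    intro h
    rw [Nat.card_eq_fintype_card] at hΓ
    have hcoeff : (e₁ Γ k).coeff 1 = 0 := by rw [h]; rfl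
    simp [e₁, MonoidAlgebra.coeff_sum, Finsupp.single_apply, hΓ.ne_zero] at hcoeff
  have hmul (x : MonoidAlgebra k Γ) : ∃ c : k, x * e₁ Γ k = c • e₁ Γ k := by
    induction x using MonoidAlgebra.induction_linear with
    | zero => exact ⟨0, by simp⟩
    | add a b ha hb =>
      obtain ⟨⟨c, hc⟩, d, hd⟩ := ha, hb
      exact ⟨c + d, by rw [add_mul, hc, hd, add_smul]⟩
    | single g r =>
      refine ⟨r, ?_⟩
      rw [show (single g r : MonoidAlgebra k Γ) = r • single g 1 by simp, smul_mul_assoc, hsingle]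
  refine ⟨hidem, Semigroup.mem_center_iff.mpr fun x => (e₁_central Γ k x).symm, hne,
    fun f hf _ hfe => ?_⟩
  obtain ⟨c, hc⟩ := hmul f
  rw [hfe] at hc
  have hcc : c * c = c := smul_left_injective k hne <| by
    simpa only [hc, smul_mul_smul_comm, hidem.eq] using hf.eq
  rcases IsIdempotentElem.iff_eq_zero_or_one.mp hcc with rfl | rfl
  · exact .inl (by rw [hc, zero_smul])
  · exact .inr (by rw [hc, one_smul])

variable {Γ : Type*} [Group Γ]

theorem coeff_antipode {R : Type*} [CommRing R] (x : MonoidAlgebra R Γ) (g : Γ) :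
    (HopfAlgebra.antipode R x).coeff g = x.coeff g⁻¹ := by
  classical
  induction x using MonoidAlgebra.induction_linear with
  | zero => simp
  | add x y hx hy => simp [hx, hy]
  | single h r => simp [Finsupp.single_apply, inv_eq_iff_eq_inv]

theorem coeff_antipode_mul_one [Fintype Γ] {R : Type*} [CommRing R] (x y : MonoidAlgebra R Γ) :
    (HopfAlgebra.antipode R x * y).coeff 1 = ∑ h, x.coeff h * y.coeff h := by
  rw [MonoidAlgebra.coeff_mul_apply_left, Finsupp.sum_fintype _ _ (by simp)]
  exact Fintype.sum_equiv (Equiv.inv Γ) _ _ fun h => by simp [coeff_antipode]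

/-- With `e*` the image of `e` under `g ↦ g⁻¹`, the central idempotent `e* e` is nonzero because its
coefficient at `1` is a sum of squares; so it is equal to `e`, and then also to `e*`. -/
theorem IsIrredCentralIdem.coeff_inv [Finite Γ] {k : Type*} [Field k] [LinearOrder k]
    [IsStrictOrderedRing k] {e : MonoidAlgebra k Γ} (he : IsIrredCentralIdem e) (g : Γ) :
    e.coeff g⁻¹ = e.coeff g := by
  have := Fintype.ofFinite Γ
  set star := HopfAlgebra.antipode k (A := MonoidAlgebra k Γ)
  have hmul (x y : MonoidAlgebra k Γ) : star (x * y) = star y * star x :=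
    HopfAlgebra.antipode_mul_antidistrib x y
  have hinvol (x : MonoidAlgebra k Γ) : star (star x) = x := by
    ext g
    rw [coeff_antipode, coeff_antipode, inv_inv]
  have hcentral : star e ∈ Set.center (MonoidAlgebra k Γ) :=
    Semigroup.mem_center_iff.mpr fun x => by
      rw [← hinvol x, ← hmul, ← hmul, (he.central.comm _).eq]
  have hcoeff : (star e * e).coeff 1 = ∑ h, e.coeff h * e.coeff h :=
    coeff_antipode_mul_one e e
  have hne : star e * e ≠ 0 := by
    intro h
    refine he.ne_zero ?_
    rw [h] at hcoeff
    ext h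
    exact mul_self_eq_zero.mp ((Finset.sum_eq_zero_iff_of_nonneg fun h _ => mul_self_nonneg _).mp
      hcoeff.symm h (Finset.mem_univ h))
  have heq : star e * e = e := by
    refine (he.irred _ ?_ (Set.mul_mem_center hcentral he.central) ?_).resolve_left hne
    · exact IsIdempotentElem.mul_of_commute (hcentral.comm e)
        (by rw [IsIdempotentElem, ← hmul, he.idem.eq]) he.idem
    · rw [mul_assoc, he.idem.eq]
  have hstar : star e = e := by
    conv_lhs => rw [← heq, hmul, hinvol, heq]
  rw [← coeff_antipode, hstar]

end GroupAlgebra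

section Representations

open MonoidAlgebra (single)

variable {k Γ V : Type*} [Field k] [Group Γ] [AddCommGroup V] [Module k V]
  (ρ : Representation k Γ V)

theorem trace_asAlgebraHom [Fintype Γ] (x : MonoidAlgebra k Γ) :
    LinearMap.trace k V (ρ.asAlgebraHom x) = ∑ g, x.coeff g * ρ.character g := by
  rw [Representation.asAlgebraHom_def, MonoidAlgebra.lift_apply, Finsupp.sum_fintype _ _ (by simp)]
  simp [Representation.character]

theorem nontrivial_of_isIrreducible [ρ.IsIrreducible] : Nontrivial V :=
  IsSimpleModule.nontrivial (MonoidAlgebra k Γ) ρ.asModule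

theorem asAlgebraHom_eq_zero_or_one [ρ.IsIrreducible] {e : MonoidAlgebra k Γ}
    (he : IsIdempotentElem e) (hc : e ∈ Set.center (MonoidAlgebra k Γ)) :
    ρ.asAlgebraHom e = 0 ∨ ρ.asAlgebraHom e = 1 := by
  let F : Representation.IntertwiningMap ρ ρ := ⟨ρ.asAlgebraHom e, fun g => by
    have h := congrArg ρ.asAlgebraHom (hc.comm (single g 1)).eq
    rwa [map_mul, map_mul, Representation.asAlgebraHom_single_one] at h⟩
  refine (Representation.IsIrreducible.bijective_or_eq_zero F).symm.imp
    (fun h => congrArg Representation.IntertwiningMap.toLinearMap h) fun h => ?_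
  refine LinearMap.ext fun v => h.1 ?_
  exact LinearMap.congr_fun (he.map ρ.asAlgebraHom).eq v

theorem asAlgebraHom_surjective [IsAlgClosed k] [FiniteDimensional k V] [ρ.IsIrreducible] :
    Function.Surjective ρ.asAlgebraHom := by
  intro f
  let F : Module.End (Module.End (MonoidAlgebra k Γ) ρ.asModule) ρ.asModule :=
    { toFun v := ρ.asModuleEquiv.symm (f (ρ.asModuleEquiv v))
      map_add' v w := by simp only [map_add]
      map_smul' c v := by
        obtain ⟨a, rfl⟩ := (IsSimpleModule.algebraMap_end_bijective_of_isAlgClosed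
          (A := MonoidAlgebra k Γ) (V := ρ.asModule) k).2 c
        change ρ.asModuleEquiv.symm (f (ρ.asModuleEquiv (a • v))) =
          a • ρ.asModuleEquiv.symm (f (ρ.asModuleEquiv v))
        simp only [map_smul] }
  let b := Module.finBasis k V
  classical
  obtain ⟨r, hr⟩ := jacobson_density F (Finset.univ.image fun i => ρ.asModuleEquiv.symm (b i))
  refine ⟨r, b.ext fun i => ?_⟩
  have h := congrArg ρ.asModuleEquiv (hr _ (Finset.mem_image_of_mem _ (Finset.mem_univ i)))
  rw [Representation.asModuleEquiv_map_smul] at h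
  simpa [F] using h.symm

theorem span_range_eq_top [IsAlgClosed k] [FiniteDimensional k V] [ρ.IsIrreducible] :
    Submodule.span k (Set.range ρ) = ⊤ := by
  refine eq_top_iff.mpr fun f _ => ?_
  obtain ⟨x, rfl⟩ := asAlgebraHom_surjective ρ f
  rw [Representation.asAlgebraHom_def, MonoidAlgebra.lift_apply]
  exact Submodule.sum_mem _ fun g _ => Submodule.smul_mem _ _ (Submodule.subset_span ⟨g, rfl⟩)

variable [Fintype Γ]

theorem sum_single_character_mul {e : MonoidAlgebra k Γ} (hsymm : ∀ g, e.coeff g⁻¹ = e.coeff g)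
    (he : ρ.asAlgebraHom e = 1) :
    (∑ g, single g (ρ.character g)) * e = ∑ g, single g (ρ.character g) := by
  classical
  have hcoeff (h : Γ) : (∑ g, single g (ρ.character g)).coeff h = ρ.character h := by
    simp [MonoidAlgebra.coeff_sum, Finsupp.single_apply]
  ext h
  rw [MonoidAlgebra.coeff_mul_apply_right, Finsupp.sum_fintype _ _ (by simp), hcoeff]
  calc ∑ g, (∑ g, single g (ρ.character g)).coeff (h * g⁻¹) * e.coeff g
      = ∑ g, (single h 1 * e).coeff g * ρ.character g := by
        simp only [hcoeff]
        refine Fintype.sum_equiv ((Equiv.inv Γ).trans (Equiv.mulLeft h)) _ _ fun g => ?_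
        simp [hsymm, mul_comm]
    _ = ρ.character h := by
        rw [← trace_asAlgebraHom, map_mul, he, mul_one, Representation.asAlgebraHom_single_one,
          Representation.character]

end Representations

section RationalAction

variable {Γ V : Type*} [Group Γ] [AddCommGroup V] [Module ℂ V] (ρ : Representation ℂ Γ V)

/-- The action of `ℚ[Γ]` on the space of a complex representation of `Γ`. -/
def ratAction : MonoidAlgebra ℚ Γ →+* Module.End ℂ V :=
  ρ.asAlgebraHom.toRingHom.comp (MonoidAlgebra.mapRingHom Γ (algebraMap ℚ ℂ))

theorem span_range_ratAction [FiniteDimensional ℂ V] [ρ.IsIrreducible] :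
    Submodule.span ℂ (Set.range (ratAction ρ)) = ⊤ := by
  refine eq_top_iff.mpr ((span_range_eq_top ρ).ge.trans (Submodule.span_mono ?_))
  rintro _ ⟨g, rfl⟩
  exact ⟨MonoidAlgebra.single g 1, by simp [ratAction]⟩

theorem mapRingHom_mem_center {R R' : Type*} [CommRing R] [CommRing R'] (f : R →+* R')
    {e : MonoidAlgebra R Γ} (hc : e ∈ Set.center (MonoidAlgebra R Γ)) :
    MonoidAlgebra.mapRingHom Γ f e ∈ Set.center (MonoidAlgebra R' Γ) := by
  refine Semigroup.mem_center_iff.mpr fun x => ?_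
  induction x using MonoidAlgebra.induction_on with
  | of g =>
    have h := congrArg (MonoidAlgebra.mapRingHom Γ f) (hc.comm (MonoidAlgebra.single g 1)).eq
    simpa using h.symm
  | add x y hx hy => rw [add_mul, mul_add, hx, hy]
  | smul r x hx => rw [smul_mul_assoc, mul_smul_comm, hx]

theorem ratAction_eq_zero_or_one [ρ.IsIrreducible] {e : MonoidAlgebra ℚ Γ}
    (he : IsIdempotentElem e) (hc : e ∈ Set.center (MonoidAlgebra ℚ Γ)) :
    ratAction ρ e = 0 ∨ ratAction ρ e = 1 :=
  asAlgebraHom_eq_zero_or_one ρ (he.map _) (mapRingHom_mem_center _ hc)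

end RationalAction

section Pairing

theorem pairing_sum_left {Γ ι : Type*} [Fintype Γ] (s : Finset ι) (χ : ι → Γ → ℂ) (ψ : Γ → ℂ) :
    pairing (∑ i ∈ s, χ i) ψ = ∑ i ∈ s, pairing (χ i) ψ := by
  simp only [pairing, Finset.sum_apply, Finset.sum_mul, ← Finset.mul_sum]
  rw [Finset.sum_comm]

variable {Γ : Type*} [Group Γ] [Fintype Γ]

open Classical in
theorem pairing_induced (Δ : Subgroup Γ) (f : Δ → ℂ) {ψ : Γ → ℂ}
    (hψ : ∀ g h, ψ (h * g * h⁻¹) = ψ g) : pairing (induced Δ f) ψ = pairing f (ψ ∘ Δ.subtype) := by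
  have hconj (x : Γ) :
      ∑ g, (if h : x⁻¹ * g * x ∈ Δ then f ⟨x⁻¹ * g * x, h⟩ else 0) * conj (ψ g) =
        ∑ δ : Δ, f δ * conj (ψ δ) := by
    symm
    refine Fintype.sum_of_injective (fun δ : Δ => x * δ * x⁻¹)
      (fun δ ε h => by simpa using h) _ _ (fun g hg => ?_) fun δ => ?_
    · rw [dif_neg fun h => hg ⟨⟨_, h⟩, by group⟩, zero_mul]
    · rw [hψ]
      simp [mul_assoc]
  simp_rw [pairing, induced, mul_assoc (Nat.card Δ : ℂ)⁻¹, Finset.sum_mul]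
  rw [← Finset.mul_sum, Finset.sum_comm, Finset.sum_congr rfl fun x _ => hconj x, Finset.sum_const,
    Finset.card_univ, nsmul_eq_mul, mul_left_comm,
    inv_mul_cancel_left₀ (Nat.cast_ne_zero.mpr Fintype.card_ne_zero), Nat.card_eq_fintype_card]
  rfl

variable {V : Type*} [AddCommGroup V] [Module ℂ V] (ρ : Representation ℂ Γ V)

theorem pairing_induced_one_character [FiniteDimensional ℂ V] (Δ : Subgroup Γ) :
    pairing (induced Δ fun _ => 1) ρ.character =
      Module.finrank ℂ (LinearMap.range (ρ.asAlgebraHom (subgroupIdem ℂ Δ))) := by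
  classical
  have hidem : IsIdempotentElem (subgroupIdem ℂ Δ) :=
    isIdempotentElem_subgroupIdem (isUnit_iff_ne_zero.mpr (Nat.cast_ne_zero.mpr Nat.card_pos.ne'))
  have htrace : (Module.finrank ℂ (LinearMap.range (ρ.asAlgebraHom (subgroupIdem ℂ Δ))) : ℂ) =
      (Nat.card Δ : ℂ)⁻¹ * ∑ δ : Δ, ρ.character δ := by
    rw [← (LinearMap.IsIdempotentElem.isProj_range _ (hidem.map ρ.asAlgebraHom)).trace,
      subgroupIdem, map_smul, map_sum]
    simp [Representation.character]
  rw [pairing_induced _ _ fun g h => ρ.char_conj g h, ← Complex.conj_natCast, htrace, pairing]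
  simp

theorem pairing_ratCharacter_eq_zero {W : Type*} [AddCommGroup W] [Module ℚ W]
    (σ : Representation ℚ Γ W) {e : MonoidAlgebra ℚ Γ} (hsymm : ∀ g, e.coeff g⁻¹ = e.coeff g)
    (hσ : σ.asAlgebraHom e = 1) (hρ : ratAction ρ e = 0) :
    pairing (fun g => (σ.character g : ℂ)) ρ.character = 0 := by
  have haction : ratAction ρ (∑ g, MonoidAlgebra.single g (σ.character g)) = 0 := by
    rw [← sum_single_character_mul σ hsymm hσ, map_mul, hρ, mul_zero]
  have hsum : ∑ g, (σ.character g : ℂ) * ρ.character g = 0 := by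
    have htrace := congrArg (LinearMap.trace ℂ V) haction
    simpa [ratAction, Representation.character, Representation.asAlgebraHom_single] using htrace
  have hconj := congrArg conj hsum
  simp only [map_sum, map_mul, map_ratCast, map_zero] at hconj
  rw [pairing, hconj, mul_zero]

theorem ratAction_eq_one_of_isAbsIrredCharIn [ρ.IsIrreducible] {e : MonoidAlgebra ℚ Γ}
    (he : IsIrredCentralIdem e) (h : IsAbsIrredCharIn e ρ.character) : ratAction ρ e = 1 := by
  obtain ⟨-, χ, ⟨m, σ, -, hσ, rfl⟩, hne⟩ := h
  exact (ratAction_eq_zero_or_one ρ he.idem he.central).resolve_left fun h0 =>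
    hne (pairing_ratCharacter_eq_zero ρ σ he.coeff_inv hσ h0)

theorem ratAction_subgroupIdem (Δ : Subgroup Γ) :
    ratAction ρ (subgroupIdem ℚ Δ) = ρ.asAlgebraHom (subgroupIdem ℂ Δ) := by
  rw [← mapRingHom_subgroupIdem (algebraMap ℚ ℂ)
    (isUnit_iff_ne_zero.mpr (Nat.cast_ne_zero.mpr Nat.card_pos.ne'))]
  rfl

theorem induced_top_one : induced (⊤ : Subgroup Γ) (fun _ => 1) = 1 := by
  ext g
  simp [induced, Nat.card_eq_fintype_card]

theorem ratAction_e₁_eq_zero {e : MonoidAlgebra ℚ Γ} (he : IsIrredCentralIdem e) (hne : e ≠ e₁ Γ ℚ)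
    (h : ratAction ρ e = 1) : ratAction ρ (e₁ Γ ℚ) = 0 := by
  have he₁ : IsIrredCentralIdem (e₁ Γ ℚ) :=
    isIrredCentralIdem_e₁ (isUnit_iff_ne_zero.mpr (Nat.cast_ne_zero.mpr Nat.card_pos.ne'))
  rw [← one_mul (ratAction ρ (e₁ Γ ℚ)), ← h, ← map_mul, he.mul_eq_zero he₁ hne, map_zero]

theorem pairing_neg_one_add_sum_induced_one [FiniteDimensional ℂ V]
    (he₁ : ratAction ρ (e₁ Γ ℚ) = 0) {ι : Type*} [Fintype ι] (Δ : ι → Subgroup Γ) :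
    pairing (fun g => -1 + ∑ i, induced (Δ i) (fun _ => 1) g) ρ.character =
      (∑ i, Module.finrank ℂ (LinearMap.range (ratAction ρ (subgroupIdem ℚ (Δ i)))) : ℕ) := by
  have hone : pairing 1 ρ.character = 0 := by
    rw [← induced_top_one, pairing_induced_one_character, ← ratAction_subgroupIdem,
      subgroupIdem_top, he₁, LinearMap.range_zero, finrank_bot, Nat.cast_zero]
  calc _ = -pairing 1 ρ.character +
        pairing (∑ i, induced (Δ i) fun _ => 1) ρ.character := by
        simp [pairing, add_mul, Finset.sum_add_distrib, mul_add, Finset.sum_neg_distrib]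
    _ = _ := by
        rw [hone, neg_zero, zero_add, pairing_sum_left, Nat.cast_sum]
        exact Finset.sum_congr rfl fun i _ => by
          rw [pairing_induced_one_character, ratAction_subgroupIdem]

end Pairing

section Center

variable {C : Type*} [Ring C]

theorem isCentral_subringCenter : Algebra.IsCentral (Subring.center C) C where
  out x hx := Algebra.mem_bot.mpr ⟨⟨x, hx⟩, rfl⟩

variable [IsSimpleRing C] [Module.Finite (Subring.center C) C] {L V : Type*} [Field L]
  [AddCommGroup V] [Module L V] [FiniteDimensional L V] [Nontrivial V] {g : C →+* Module.End L V}

theorem finrank_center_eq_sq (hg : Submodule.span L (Set.range g) = ⊤) :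
    Module.finrank (Subring.center C) C = Module.finrank L V ^ 2 := by
  have := isCentral_subringCenter (C := C)
  let _ : Field (Subring.center C) := (IsSimpleRing.isField_center C).toField
  exact finrank_eq_sq hg

theorem nonempty_linearEquiv_pi_span_singleton_one
    (hg : Submodule.span L (Set.range g) = ⊤) (c : C) :
    Nonempty ((Fin (Module.finrank L V) → Ideal.span {c}) ≃ₗ[C]
      (Fin (Module.finrank L (LinearMap.range (g c))) → Ideal.span {(1 : C)})) := by
  have := isCentral_subringCenter (C := C)
  let _ : Field (Subring.center C) := (IsSimpleRing.isField_center C).toField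
  obtain ⟨θ⟩ := nonempty_linearEquiv_pi_span_singleton (K := Subring.center C) hg c
  exact ⟨θ.trans (.piCongrRight fun _ =>
    Submodule.topEquiv.symm.trans (.ofEq _ _ Ideal.span_singleton_one.symm))⟩

end Center

section Corner

variable {B : Type*} [Ring B] {e : B}

/-- The action of the ring `eB` on a space on which `e` acts as the identity. -/
def cornerAction {L V : Type*} [Field L] [AddCommGroup V] [Module L V] (he : IsIdempotentElem e)
    (g : B →+* Module.End L V) (hge : g e = 1) : he.Corner →+* Module.End L V where
  toFun x := g x.1
  map_one' := hge
  map_mul' x y := map_mul g x.1 y.1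
  map_zero' := map_zero g
  map_add' x y := map_add g x.1 y.1

variable (he : IsIdempotentElem e) (hc : e ∈ Set.center B)

theorem isAddTorsionFree_corner [IsAddTorsionFree B] : IsAddTorsionFree he.Corner :=
  Function.Injective.isAddTorsionFree
    (⟨⟨Subtype.val, rfl⟩, fun _ _ => rfl⟩ : he.Corner →+ B) Subtype.val_injective

include hc

theorem finite_center_corner [Algebra ℚ B] [FiniteDimensional ℚ B] :
    Module.Finite (Subring.center he.Corner) he.Corner := by
  let π := toCorner he hc
  let _ : Algebra ℚ he.Corner := (π.comp (algebraMap ℚ B)).toAlgebra' fun c x => by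
    rw [← toCorner_coe he hc x, RingHom.comp_apply, ← map_mul, ← map_mul, Algebra.commutes]
  let πₐ : B →ₐ[ℚ] he.Corner := { π with commutes' := fun _ => rfl }
  have : Module.Finite ℚ he.Corner :=
    .of_surjective πₐ.toLinearMap fun x => ⟨x.1, toCorner_coe he hc x⟩
  exact Module.Finite.of_restrictScalars_finite ℚ (Subalgebra.center ℚ he.Corner) he.Corner

variable {L V : Type*} [Field L] [AddCommGroup V] [Module L V] {g : B →+* Module.End L V}
  (hge : g e = 1) (hg : Submodule.span L (Set.range g) = ⊤)

theorem cornerAction_toCorner (x : B) : cornerAction he g hge (toCorner he hc x) = g x := by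
  change g (e * x) = g x
  rw [map_mul, hge, one_mul]

include hg in
theorem span_range_cornerAction : Submodule.span L (Set.range (cornerAction he g hge)) = ⊤ := by
  refine eq_top_iff.mpr (hg.ge.trans (Submodule.span_mono ?_))
  rintro _ ⟨x, rfl⟩
  exact ⟨toCorner he hc x, cornerAction_toCorner he hc hge x⟩

end Corner

section Order

variable {B : Type*} [Ring B] {e : B} {A : Type*} [Ring A] {f : A →+* B}

theorem eq_zero_of_toCorner_eq_zero (he : IsIdempotentElem e) (hc : e ∈ Set.center B)
    (hf : Function.Injective f) {a : A} (ha : f a = e) {x : A} (hx : x ∈ Ideal.span {a})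
    (hx₀ : toCorner he hc (f x) = 0) : x = 0 := by
  obtain ⟨y, rfl⟩ := Ideal.mem_span_singleton'.mp hx
  have h : e * f (y * a) = 0 := congrArg Subtype.val hx₀
  refine hf ?_
  rwa [map_mul, ha, (hc.comm _).eq, mul_assoc, he.eq, ← ha, ← map_mul, ← map_zero f] at h

theorem exists_nsmul_mem_range_toCorner (he : IsIdempotentElem e) (hc : e ∈ Set.center B)
    (hfull : ∀ b : B, ∃ m : ℕ, m ≠ 0 ∧ m • b ∈ Set.range f) (v : he.Corner) :
    ∃ m : ℕ, m ≠ 0 ∧ m • v ∈ Set.range ((toCorner he hc).comp f) := by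
  obtain ⟨m, hm, x, hx⟩ := hfull v.1
  exact ⟨m, hm, x, by rw [RingHom.comp_apply, hx, map_nsmul, toCorner_coe]⟩

variable [Algebra ℚ B] [FiniteDimensional ℚ B] [IsSemisimpleRing B] (he : IsIrredCentralIdem e)
  {L V : Type*} [Field L] [AddCommGroup V] [Module L V] [FiniteDimensional L V] [Nontrivial V]
  {g : B →+* Module.End L V} (hge : g e = 1) (hg : Submodule.span L (Set.range g) = ⊤)

include hge hg

theorem hDim_eq_finrank : hDim he = Module.finrank L V := by
  have := he.isSimpleRing_corner
  have := finite_center_corner he.idem he.central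
  rw [hDim, finrank_center_eq_sq (span_range_cornerAction he.idem he.central hge hg), Nat.cast_pow,
    Real.sqrt_sq (Nat.cast_nonneg _)]

include he

theorem natCard_range_mul_smul_pow_eq (hA : IsSemisimpleModPrimes A) (hf : Function.Injective f)
    (hfull : ∀ b : B, ∃ m : ℕ, m ≠ 0 ∧ m • b ∈ Set.range f) {a s : A} (ha : f a = e)
    (hs : IsIdempotentElem s) (M : Type*) [AddCommGroup M] [Module A M] [Finite M] :
    Nat.card (DistribSMul.toAddMonoidHom M (a * s)).range ^ Module.finrank L V =
      Nat.card (DistribSMul.toAddMonoidHom M a).range ^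
        Module.finrank L (LinearMap.range (g (f s))) := by
  have := he.isSimpleRing_corner
  have := finite_center_corner he.idem he.central
  have : IsAddTorsionFree B := .of_module_rat B
  have := isAddTorsionFree_corner he.idem
  have ha_idem : IsIdempotentElem a := hf (by rw [map_mul, ha, he.idem.eq])
  have hcomm : Commute a s := hf (by rw [map_mul, map_mul, ha, (he.central.comm (f s)).eq])
  have hle : Ideal.span {a * s} ≤ Ideal.span {a} :=
    (Ideal.span_singleton_le_iff_mem _).mpr (Ideal.mem_span_singleton'.mpr ⟨s, hcomm.symm⟩)
  let F := (toCorner he.idem he.central).comp f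
  have hFa : F a = 1 := by rw [RingHom.comp_apply, ha]; exact Subtype.ext he.idem.eq
  have hgs : cornerAction he.idem g hge (F (a * s)) = g (f s) := by
    rw [RingHom.comp_apply, cornerAction_toCorner, map_mul, map_mul, ha, hge, one_mul]
  obtain ⟨θ⟩ := nonempty_linearEquiv_pi_span_singleton_one
    (span_range_cornerAction he.idem he.central hge hg) (F (a * s))
  rw [hgs, ← hFa] at θ
  exact natCard_range_smul_pow_eq hA ha_idem (ha_idem.mul_of_commute hcomm hs)
    (exists_nsmul_mem_range_toCorner he.idem he.central hfull)
    (fun x hx => eq_zero_of_toCorner_eq_zero he.idem he.central hf ha hx)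
    (fun x hx => eq_zero_of_toCorner_eq_zero he.idem he.central hf ha (hle hx)) θ

end Order

section OrthogonalIdempotents

theorem completeOrthogonalIdempotents_subtype {A ι : Type*} [Ring A] [Fintype ι] {a : ι → A}
    (ha : CompleteOrthogonalIdempotents a) {p : ι → Prop} [Fintype (Subtype p)]
    (hp : ∀ i, ¬ p i → a i = 0) : CompleteOrthogonalIdempotents fun i : Subtype p => a i where
  idem i := ha.idem i
  ortho i j hij := ha.ortho (Subtype.coe_injective.ne hij)
  complete := by
    classical
    rw [← ha.complete, ← Finset.sum_subtype (Finset.univ.filter p) (fun i => by simp) a]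
    exact Finset.sum_subset (Finset.filter_subset _ _) fun i _ hi => hp i (by simpa using hi)

theorem natCard_range_smul_eq_prod {A ι : Type*} [Ring A] [Fintype ι] {a : ι → A}
    (ha : CompleteOrthogonalIdempotents a) {s : A} (hs : ∀ i, Commute (a i) s)
    (M : Type*) [AddCommGroup M] [Module A M] :
    Nat.card (DistribSMul.toAddMonoidHom M s).range =
      ∏ i, Nat.card (DistribSMul.toAddMonoidHom M (a i * s)).range := by
  have hdecomp (x : M) : ∑ i, a i • x = x := by rw [← Finset.sum_smul, ha.complete, one_smul]
  let f (x : (DistribSMul.toAddMonoidHom M s).range) (i : ι) :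
      (DistribSMul.toAddMonoidHom M (a i * s)).range :=
    ⟨a i • x.1, by obtain ⟨y, hy⟩ := x.2; exact ⟨y, hy ▸ mul_smul _ _ _⟩⟩
  rw [← Nat.card_pi]
  refine Nat.card_eq_of_bijective f ⟨fun x y h => Subtype.ext ?_, fun z => ?_⟩
  · rw [← hdecomp x.1, ← hdecomp y.1]
    exact Finset.sum_congr rfl fun i _ => congrArg Subtype.val (congrFun h i)
  · choose y hy using fun i => (z i).2
    refine ⟨⟨∑ i, (z i).1, sum_mem fun i _ => ⟨a i • y i, ?_⟩⟩, funext fun i => Subtype.ext ?_⟩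
    · rw [← hy, (hs i).eq]
      exact (mul_smul _ _ _).symm
    · classical
      change a i • ∑ j, (z j).1 = (z i).1
      rw [Finset.smul_sum, Finset.sum_eq_single_of_mem i (Finset.mem_univ i) fun j _ hj => ?_]
      all_goals rw [← hy]; change a i • (a _ * s) • y _ = _; rw [smul_smul, ← mul_assoc]
      · rw [(ha.idem i).eq]; rfl
      · rw [ha.ortho hj.symm, zero_mul, zero_smul]

end OrthogonalIdempotents

section IntegralGroupRing

variable {Γ : Type*} {S : Set Nat.Primes}

theorem exists_nsmul_mem_range_mapRingHom [Monoid Γ] {R : Type*} [CommRing R] (f : R →+* ℚ)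
    (b : MonoidAlgebra ℚ Γ) :
    ∃ m : ℕ, m ≠ 0 ∧ m • b ∈ Set.range (MonoidAlgebra.mapRingHom Γ f) := by
  induction b using MonoidAlgebra.induction_on with
  | of g => exact ⟨1, one_ne_zero, .single g 1, by simp⟩
  | add x y hx hy =>
    obtain ⟨m, hm, x', hx'⟩ := hx
    obtain ⟨n, hn, y', hy'⟩ := hy
    refine ⟨m * n, mul_ne_zero hm hn, n • x' + m • y', ?_⟩
    rw [map_add, map_nsmul, map_nsmul, hx', hy', smul_add, smul_smul, smul_smul, mul_comm n m]
  | smul q x hx =>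
    obtain ⟨m, hm, x', hx'⟩ := hx
    refine ⟨q.den * m, mul_ne_zero q.den_nz hm, q.num • x', ?_⟩
    rw [map_zsmul, hx', mul_smul, smul_comm m q x, ← Nat.cast_smul_eq_nsmul ℚ q.den, smul_smul,
      mul_comm (q.den : ℚ), Rat.mul_den_eq_num, Int.cast_smul_eq_zsmul]

theorem ZS.toRat_injective : Function.Injective (ZS.toRat S) := by
  refine (IsLocalization.lift_injective_iff _).mpr fun x y => ?_
  have hle : primeToS S ≤ nonZeroDivisors ℤ := fun n hn => mem_nonZeroDivisors_of_ne_zero hn.1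
  rw [(IsLocalization.injective (ZS S) hle).eq_iff]
  simp

theorem ZS.isUnit_natCast {n : ℕ} (hn : n ≠ 0) (h : ∀ p ∈ S, ¬ (p : ℕ) ∣ n) :
    IsUnit (n : ZS S) := by
  have := IsLocalization.map_units (ZS S) (⟨(n : ℤ), by exact_mod_cast hn, fun p hp hd =>
    h p hp (by exact_mod_cast hd)⟩ : primeToS S)
  simpa using this

theorem mapRingHom_toRat_injective [Monoid Γ] :
    Function.Injective (MonoidAlgebra.mapRingHom Γ (ZS.toRat S)) :=
  MonoidAlgebra.map_injective (ZS.toRat S : ZS S →+ ℚ) ZS.toRat_injective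

theorem commute_of_mapRingHom_toRat_eq [Monoid Γ] {e : MonoidAlgebra ℚ Γ}
    (hc : e ∈ Set.center (MonoidAlgebra ℚ Γ)) {a : MonoidAlgebra (ZS S) Γ}
    (ha : MonoidAlgebra.mapRingHom Γ (ZS.toRat S) a = e) (x : MonoidAlgebra (ZS S) Γ) :
    Commute a x :=
  mapRingHom_toRat_injective (by rw [map_mul, map_mul, ha, (hc.comm _).eq])

variable [Group Γ] [Fintype Γ] (hS : ∀ p ∈ S, ¬ (p : ℕ) ∣ Fintype.card Γ)

include hS

theorem isUnit_natCard_subgroup (Δ : Subgroup Γ) : IsUnit (Nat.card Δ : ZS S) :=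
  ZS.isUnit_natCast Nat.card_pos.ne' fun p hp hd =>
    hS p hp (Nat.card_eq_fintype_card (α := Γ) ▸ hd.trans (Subgroup.card_subgroup_dvd_card Δ))

theorem isSemisimpleModPrimes_integralGroupRing :
    IsSemisimpleModPrimes (MonoidAlgebra (ZS S) Γ) :=
  isSemisimpleModPrimes_monoidAlgebra
    (ZS.isUnit_natCast Nat.card_pos.ne' (by rwa [Nat.card_eq_fintype_card]))
    fun _ hp => isMaximal_span_natCast (primeToS S) hp

theorem exists_mapRingHom_toRat_eq {e : MonoidAlgebra ℚ Γ} (he : IsIdempotentElem e)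
    (hc : e ∈ Set.center (MonoidAlgebra ℚ Γ)) :
    ∃ a, MonoidAlgebra.mapRingHom Γ (ZS.toRat S) a = e := by
  have : IsAddTorsionFree (MonoidAlgebra ℚ Γ) := .of_module_rat _
  obtain ⟨m, hm, y, hy⟩ := exists_nsmul_mem_range_mapRingHom (ZS.toRat S) e
  exact (isSemisimpleModPrimes_integralGroupRing hS).exists_map_eq mapRingHom_toRat_injective
    he hc hm y hy

theorem toReduced_eq_zero_of_mapRingHom_eq {x : MonoidAlgebra (ZS S) Γ}
    (hx : MonoidAlgebra.mapRingHom Γ (ZS.toRat S) x = e₁ Γ ℚ) : toReduced Γ S x = 0 := by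
  have hx₁ : x = e₁ Γ (ZS S) := mapRingHom_toRat_injective <| by
    rw [hx, ← subgroupIdem_top, ← subgroupIdem_top,
      mapRingHom_subgroupIdem _ (isUnit_natCard_subgroup hS ⊤)]
  rw [hx₁]
  exact Ideal.Quotient.eq_zero_iff_mem.mpr (Ideal.mem_span_singleton_self _)

theorem completeOrthogonalIdempotents_toReduced [Fintype (Idx Γ)]
    {a : {e : MonoidAlgebra ℚ Γ // IsIrredCentralIdem e} → MonoidAlgebra (ZS S) Γ}
    (ha : ∀ e, MonoidAlgebra.mapRingHom Γ (ZS.toRat S) (a e) = e.1) :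
    CompleteOrthogonalIdempotents fun i : Idx Γ => toReduced Γ S (a i.1) := by
  have : Fintype {e : MonoidAlgebra ℚ Γ // IsIrredCentralIdem e} := Fintype.ofFinite _
  have : IsArtinianRing (MonoidAlgebra ℚ Γ) := .of_finite ℚ _
  have hcomplete : CompleteOrthogonalIdempotents a := by
    rw [← CompleteOrthogonalIdempotents.map_injective_iff _ mapRingHom_toRat_injective]
    rw [show _ ∘ a = Subtype.val from funext ha]
    exact completeOrthogonalIdempotents_irredCentralIdem
  refine completeOrthogonalIdempotents_subtype (hcomplete.map (toReduced Γ S)) fun e he => ?_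
  exact toReduced_eq_zero_of_mapRingHom_eq hS ((ha e).trans (not_not.mp he))

end IntegralGroupRing

section ReducedModules

variable {Γ : Type*} [Group Γ] [Fintype Γ] {S : Set Nat.Primes}
  (H : Type*) [AddCommGroup H] [Module (ReducedRing Γ S) H]

theorem idemPart_eq_range {e : MonoidAlgebra ℚ Γ} {a : MonoidAlgebra (ZS S) Γ}
    (ha : MonoidAlgebra.mapRingHom Γ (ZS.toRat S) a = e) :
    idemPart (S := S) H e = (DistribSMul.toAddMonoidHom H (toReduced Γ S a)).range := by
  refine le_antisymm (iSup_le fun r => ?_) (le_iSup_of_le ⟨a, ha⟩ le_rfl)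
  rw [show r.1 = a from mapRingHom_toRat_injective (r.2.trans ha.symm)]

variable (hS : ∀ p ∈ S, ¬ (p : ℕ) ∣ Fintype.card Γ)

include hS

theorem fixedPart_eq_range (Δ : Subgroup Γ) :
    fixedPart (S := S) H Δ =
      (DistribSMul.toAddMonoidHom H (toReduced Γ S (subgroupIdem (ZS S) Δ))).range := by
  let _ : Module (MonoidAlgebra (ZS S) Γ) H := Module.compHom H (toReduced Γ S)
  ext x
  refine ⟨fun hx => ⟨x, subgroupIdem_smul_eq_self (isUnit_natCard_subgroup hS Δ) hx⟩, ?_⟩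
  rintro ⟨y, rfl⟩ γ hγ
  change toReduced Γ S _ • toReduced Γ S _ • y = toReduced Γ S _ • y
  rw [smul_smul, ← map_mul, MonoidAlgebra.of_apply, single_mul_subgroupIdem hγ]

theorem natCard_fixedPart_eq_prod [Fintype (Idx Γ)]
    {a : {e : MonoidAlgebra ℚ Γ // IsIrredCentralIdem e} → MonoidAlgebra (ZS S) Γ}
    (ha : ∀ e, MonoidAlgebra.mapRingHom Γ (ZS.toRat S) (a e) = e.1) (Δ : Subgroup Γ) :
    Nat.card (fixedPart (S := S) H Δ) = ∏ i : Idx Γ, Nat.card (DistribSMul.toAddMonoidHom H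
      (toReduced Γ S (a i.1 * subgroupIdem (ZS S) Δ))).range := by
  rw [fixedPart_eq_range H hS]
  simp only [map_mul]
  exact natCard_range_smul_eq_prod (completeOrthogonalIdempotents_toReduced hS ha) (fun i =>
    (commute_of_mapRingHom_toRat_eq i.1.2.central (ha i.1) _).map (toReduced Γ S)) H

end ReducedModules

section Rank

variable {Γ : Type*} [Group Γ] [Fintype Γ] {S : Set Nat.Primes}
  (hS : ∀ p ∈ S, ¬ (p : ℕ) ∣ Fintype.card Γ)
  (H : Type*) [AddCommGroup H] [Module (ReducedRing Γ S) H] [Finite H]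

include hS

section

variable {V : Type*} [AddCommGroup V] [Module ℂ V] [FiniteDimensional ℂ V]
  (ρ : Representation ℂ Γ V) [ρ.IsIrreducible] {e : MonoidAlgebra ℚ Γ}
  (he : IsIrredCentralIdem e) (hρ : ratAction ρ e = 1) {a : MonoidAlgebra (ZS S) Γ}
  (ha : MonoidAlgebra.mapRingHom Γ (ZS.toRat S) a = e)

include he hρ ha

theorem natCard_range_toReduced_pow_eq (Δ : Subgroup Γ) :
    Nat.card (DistribSMul.toAddMonoidHom H
        (toReduced Γ S (a * subgroupIdem (ZS S) Δ))).range ^ Module.finrank ℂ V =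
      Nat.card (idemPart (S := S) H e) ^
        Module.finrank ℂ (LinearMap.range (ratAction ρ (subgroupIdem ℚ Δ))) := by
  let _ : Module (MonoidAlgebra (ZS S) Γ) H := Module.compHom H (toReduced Γ S)
  have := nontrivial_of_isIrreducible ρ
  have : NeZero (Nat.card Γ : ℚ) := ⟨Nat.cast_ne_zero.mpr Nat.card_pos.ne'⟩
  have hΔ := isUnit_natCard_subgroup hS Δ
  rw [idemPart_eq_range H ha, ← mapRingHom_subgroupIdem (ZS.toRat S) hΔ]
  exact natCard_range_mul_smul_pow_eq he hρ (span_range_ratAction ρ)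
    (isSemisimpleModPrimes_integralGroupRing hS) mapRingHom_toRat_injective
    (exists_nsmul_mem_range_mapRingHom _) ha (isIdempotentElem_subgroupIdem hΔ) H

theorem natCard_idemPart_rpow_eq_prod (hne : e ≠ e₁ Γ ℚ) {ι : Type*} [Fintype ι]
    (Δ : ι → Subgroup Γ) :
    (Nat.card (idemPart (S := S) H e) : ℝ) ^ (1 / hDim he *
        (pairing (fun g => -1 + ∑ i, induced (Δ i) (fun _ => 1) g) ρ.character).re) =
      ∏ i, (Nat.card (DistribSMul.toAddMonoidHom H
        (toReduced Γ S (a * subgroupIdem (ZS S) (Δ i)))).range : ℝ) := by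
  have := nontrivial_of_isIrreducible ρ
  have : NeZero (Nat.card Γ : ℚ) := ⟨Nat.cast_ne_zero.mpr Nat.card_pos.ne'⟩
  have hcard : (∏ i, (Nat.card (DistribSMul.toAddMonoidHom H
      (toReduced Γ S (a * subgroupIdem (ZS S) (Δ i)))).range : ℝ)) ^ Module.finrank ℂ V =
      (Nat.card (idemPart (S := S) H e) : ℝ) ^
        ∑ i, Module.finrank ℂ (LinearMap.range (ratAction ρ (subgroupIdem ℚ (Δ i)))) := by
    rw [← Finset.prod_pow, ← Finset.prod_pow_eq_pow_sum]
    exact_mod_cast Finset.prod_congr rfl fun i _ =>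
      natCard_range_toReduced_pow_eq hS H ρ he hρ ha (Δ i)
  rw [hDim_eq_finrank he hρ (span_range_ratAction ρ),
    pairing_neg_one_add_sum_induced_one ρ (ratAction_e₁_eq_zero ρ he hne hρ), Complex.natCast_re,
    one_div, mul_comm, Real.rpow_mul (Nat.cast_nonneg _), Real.rpow_natCast, ← hcard,
    Real.pow_rpow_inv_natCast (Finset.prod_nonneg fun i _ => Nat.cast_nonneg _)
      Module.finrank_pos.ne']

end

theorem weight_eq_prod_natCard_fixedPart {φ : Idx Γ → Γ → ℂ}
    (hφ : ∀ i, IsAbsIrredCharIn i.1.1 (φ i)) {ι : Type*} [Fintype ι] (Δ : ι → Subgroup Γ) :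
    weight (S := S) H (fun i => 1 / hDim i.1.2 *
        (pairing (fun g => -1 + ∑ j, induced (Δ j) (fun _ => 1) g) (φ i)).re) =
      ∏ j, (Nat.card (fixedPart (S := S) H (Δ j)) : ℝ) := by
  have : Fintype (Idx Γ) := Fintype.ofFinite _
  choose a ha using fun e : {e : MonoidAlgebra ℚ Γ // IsIrredCentralIdem e} =>
    exists_mapRingHom_toRat_eq hS e.2.idem e.2.central
  simp only [weight, finprod_eq_prod_of_fintype, natCard_fixedPart_eq_prod H hS ha, Nat.cast_prod]
  rw [Finset.prod_comm]
  refine Finset.prod_congr rfl fun i _ => ?_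
  obtain ⟨n, ρ, hρ, hφρ⟩ := (hφ i).1
  have hρ_one := ratAction_eq_one_of_isAbsIrredCharIn ρ i.1.2 (hφρ ▸ hφ i)
  rw [hφρ]
  exact natCard_idemPart_rpow_eq_prod hS H ρ i.1.2 hρ_one (ha i.1) i.2 Δ

theorem weight_rank_eq_prod_natCard_fixedPart {K₀ K : Type*} [Field K₀] [NumberField K₀] [Field K]
    [Algebra K₀ K] (τ : Gal(K/K₀) ≃* Γ)
    (w : NumberField.InfinitePlace K₀ → NumberField.InfinitePlace K) {φ : Idx Γ → Γ → ℂ}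
    (hφ : ∀ i, IsAbsIrredCharIn i.1.1 (φ i)) :
    weight (S := S) H (rank τ w φ) =
      ∏ v, (Nat.card (fixedPart (S := S) H (decomp τ (w v))) : ℝ) :=
  weight_eq_prod_natCard_fixedPart hS H hφ fun v => decomp τ (w v)

end Rank

section Laws

variable {Γ : Type*} [Group Γ] [Fintype Γ] {S : Set Nat.Primes}

theorem autCard_pos (G : FinMod (ReducedRing Γ S)) : 0 < autCard G :=
  have : Finite (G.carrier ≃ₗ[ReducedRing Γ S] G.carrier) := DFunLike.finite _
  Nat.cast_pos.mpr Nat.card_pos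

theorem weight_pos (H : Type*) [AddCommGroup H] [Module (ReducedRing Γ S) H] [Finite H]
    (u : Idx Γ → ℝ) : 0 < weight (S := S) H u :=
  finprod_induction (0 < ·) zero_lt_one (fun _ _ => mul_pos) fun _ =>
    Real.rpow_pos_of_pos (Nat.cast_pos.mpr Nat.card_pos) _

theorem IsCohenMartinetLaw.prob_pos {u : Idx Γ → ℝ} {P : PMF (IsoClass (ReducedRing Γ S))}
    (hP : IsCohenMartinetLaw u P) (G : FinMod (ReducedRing Γ S)) : 0 < prob P G := by
  refine ENNReal.toReal_nonneg.lt_of_ne' fun h0 => zero_ne_one (α := ℝ) ?_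
  have hratio := hP G G
  rwa [prob, h0, div_zero,
    div_self (mul_pos (weight_pos G.carrier u) (autCard_pos G)).ne'] at hratio

theorem isCohenMartinetLaw_iff_exists_prob_eq (u : Idx Γ → ℝ)
    (P : PMF (IsoClass (ReducedRing Γ S))) :
    IsCohenMartinetLaw u P ↔
      ∃ c : ℝ, 0 < c ∧ ∀ G, prob P G = c / (weight (S := S) G.carrier u * autCard G) := by
  have hpos (G : FinMod (ReducedRing Γ S)) : 0 < weight (S := S) G.carrier u * autCard G :=
    mul_pos (weight_pos G.carrier u) (autCard_pos G)
  constructor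
  · intro hP
    let G₀ : FinMod (ReducedRing Γ S) := ⟨PUnit⟩
    have hprob := hP.prob_pos G₀
    refine ⟨prob P G₀ * (weight (S := S) G₀.carrier u * autCard G₀), mul_pos hprob (hpos G₀),
      fun G => ?_⟩
    rw [mul_div_assoc, ← hP G G₀, mul_div_cancel₀ _ hprob.ne']
  · rintro ⟨c, hc, hP⟩ G₁ G₂
    rw [hP, hP, div_div_div_cancel_left' _ _ hc.ne']

end Laws

section FixedPoints

variable {Γ : Type*} [Group Γ] [Fintype Γ] {S : Set Nat.Primes}
  (H : Type*) [AddCommGroup H] [Module (ReducedRing Γ S) H]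

theorem natCard_fixedPart_map_conj (g : Γ) (Δ : Subgroup Γ) :
    Nat.card (fixedPart (S := S) H (Δ.map (MulAut.conj g).toMonoidHom)) =
      Nat.card (fixedPart (S := S) H Δ) := by
  let _ : MulAction Γ H := MulAction.compHom H
    ((toReduced Γ S).toMonoidHom.comp (MonoidAlgebra.of (ZS S) Γ))
  refine (Nat.card_congr ((MulAction.toPerm g).subtypeEquiv fun x => ?_)).symm
  change (∀ γ ∈ Δ, γ • x = x) ↔ ∀ γ ∈ Δ.map (MulAut.conj g).toMonoidHom, γ • g • x = g • x
  have hconj (γ : Γ) : (g * γ * g⁻¹) • g • x = g • x ↔ γ • x = x := by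
    rw [smul_smul, inv_mul_cancel_right, mul_smul, smul_left_cancel_iff]
  simp [hconj]

end FixedPoints

section InfinitePlaces

theorem decomp_smul {Γ K₀ K : Type*} [Group Γ] [Field K₀] [Field K] [Algebra K₀ K]
    (τ : Gal(K/K₀) ≃* Γ) (σ : Gal(K/K₀)) (w : NumberField.InfinitePlace K) :
    decomp τ (σ • w) = (decomp τ w).map (MulAut.conj (τ σ)).toMonoidHom := by
  rw [decomp, decomp, MulAction.stabilizer_smul_eq_stabilizer_map_conj, Subgroup.map_map,
    Subgroup.map_map]
  congr 1
  ext
  simp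

theorem subsingleton_infinitePlace_of_finrank_eq_one {K : Type*} [Field K] [NumberField K]
    (h : Module.finrank ℚ K = 1) : Subsingleton (NumberField.InfinitePlace K) := by
  have : Subsingleton (K →+* ℂ) := by
    rw [← Fintype.card_le_one_iff_subsingleton, NumberField.Embeddings.card, h]
  have hsurj : Function.Surjective (NumberField.InfinitePlace.mk (K := K)) := fun v =>
    ⟨v.embedding, v.mk_embedding⟩
  exact hsurj.subsingleton

end InfinitePlaces

end CohenMartinet

end

theorem mainTheorem7
    {Γ : Type*} [Group Γ] [Fintype Γ]
    {K₀ K : Type*} [Field K₀] [NumberField K₀] [Field K] [NumberField K]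
    [Algebra K₀ K] [IsGalois K₀ K] (τ : Gal(K/K₀) ≃* Γ)
    (w : NumberField.InfinitePlace K₀ → NumberField.InfinitePlace K)
    (hw : ∀ v, (w v).comap (algebraMap K₀ K) = v)
    (φ : CohenMartinet.Idx Γ → Γ → ℂ)
    (hφ : ∀ i, CohenMartinet.IsAbsIrredCharIn i.1.1 (φ i))
    (S : Set Nat.Primes) (hS : ∀ p ∈ S, ¬ (p : ℕ) ∣ Fintype.card Γ) :
    (∀ (H : Type*) [AddCommGroup H] [Module (CohenMartinet.ReducedRing Γ S) H] [Finite H],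
      CohenMartinet.weight (S := S) H (CohenMartinet.rank τ w φ) =
        ∏ v : NumberField.InfinitePlace K₀,
          (Nat.card (CohenMartinet.fixedPart (S := S) H (CohenMartinet.decomp τ (w v))) : ℝ)) ∧
    (∀ P : PMF (CohenMartinet.IsoClass (CohenMartinet.ReducedRing Γ S)),
      CohenMartinet.IsCohenMartinetLaw (CohenMartinet.rank τ w φ) P ↔
        ∃ c : ℝ, 0 < c ∧ ∀ H : CohenMartinet.FinMod (CohenMartinet.ReducedRing Γ S),
          CohenMartinet.prob P H =
            c / ((∏ v : NumberField.InfinitePlace K₀, (Nat.card (CohenMartinet.fixedPart (S := S)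
              H.carrier (CohenMartinet.decomp τ (w v))) : ℝ)) * CohenMartinet.autCard H)) ∧
    (Module.finrank ℚ K₀ = 1 → ∀ winf : NumberField.InfinitePlace K,
      ∀ P : PMF (CohenMartinet.IsoClass (CohenMartinet.ReducedRing Γ S)),
        CohenMartinet.IsCohenMartinetLaw (CohenMartinet.rank τ w φ) P ↔
          ∃ c : ℝ, 0 < c ∧ ∀ H : CohenMartinet.FinMod (CohenMartinet.ReducedRing Γ S),
            CohenMartinet.prob P H =
              c / ((Nat.card (CohenMartinet.fixedPart (S := S)
                H.carrier (CohenMartinet.decomp τ winf)) : ℝ) * CohenMartinet.autCard H)) := by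
  have hweight (H : Type) [AddCommGroup H] [Module (CohenMartinet.ReducedRing Γ S) H] [Finite H] :=
    CohenMartinet.weight_rank_eq_prod_natCard_fixedPart hS H τ w hφ
  have hlaw := CohenMartinet.isCohenMartinetLaw_iff_exists_prob_eq (S := S)
    (CohenMartinet.rank τ w φ)
  simp only [hweight] at hlaw
  refine ⟨fun H _ _ _ => CohenMartinet.weight_rank_eq_prod_natCard_fixedPart hS H τ w hφ, hlaw,
    fun hK₀ winf P => ?_⟩
  have := CohenMartinet.subsingleton_infinitePlace_of_finrank_eq_one hK₀
  let v : NumberField.InfinitePlace K₀ := winf.comap (algebraMap K₀ K)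
  obtain ⟨σ, hσ⟩ := NumberField.InfinitePlace.exists_smul_eq_of_comap_eq (k := K₀) (w := winf)
    (w' := w v) (hw v).symm
  simp only [hlaw, Fintype.prod_subsingleton _ v, ← hσ, CohenMartinet.decomp_smul,
    CohenMartinet.natCard_fixedPart_map_conj]
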